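/- **Corollary (Convergence of SWIFT under Uniform Client Influence).** *Problem.* Let $n\ge 2$ clients have uniform influence scores $p_i=1/n$. Let $\ell(x,\xi)$, $x\in\mathbb R^d$, be a measurable loss, differentiable in $x$, let $\mathcal D_i$ be the data distribution of client $i$, and put $f_i(x)=\mathbb E_{\xi\sim\mathcal D_i}\ell(x,\xi)$ (assumed to exist), $f=\sum_i p_if_i$. Assume: (1) each $f_i$ is differentiable and $\|\nabla f_i(x)-\nabla f_i(y)\|\le L\|x-y\|$; (2) $\mathbb E_{\xi\sim\mathcal D_i}\nabla\ell(x,\xi)=\nabla f_i(x)$; (3) for all $x$ and $i$, $\sum_j p_j\|\nabla f(x)-\nabla f_j(x)\|^2\le\zeta^2$ and $\mathbb E_{\xi\sim\mathcal D_i}\|\nabla f_i(x)-\nabla\ell(x,\xi)\|^2\le\sigma^2$, with $\sigma,\zeta\ge0$. Let $x^\star$ be a minimizer of $f$ and $\Delta_f=f(x^0)-f(x^\star)$. *Communication.* Let $\mathcal G_t$ be communication graphs on the clients such that, for some integer $B\ge1$, the union of the $\mathcal G_t$ over every window $kB\le t<(k+1)B$ is connected. Let $w^t_{j,i}\ge 0$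 be communication coefficients with $w^t_{j,i}=0$ unless $j=i$ or $j$ is a neighbour of $i$ in $\mathcal G_t$, $\sum_j w^t_{j,i}=1$ and $w^t_{i,i}\ge 1/n$. Each client has a counter, initially $1$, that increases by one each time the client is active, and the communication set is $\mathcal C_s=\{c : c \bmod (s+1)=0,\ c\le T\}$. Let $\tilde w^t_{j,i}=w^t_{j,i}$ if the counter of $i$ at iteration $t$ is in $\mathcal C_s$ and $\tilde w^t_{j,i}=\mathbf 1_{j=i}$ otherwise. Assume that for every iteration $t<T$ and every sequence of active clients the coefficients satisfy the symmetry condition $p_j\tilde w^t_{i,j}=p_i\tilde w^t_{j,i}$, and that some $\rho\in[0,1)$ satisfies $\max\{|\lambda_2|,|\lambda_n|\}\le\rho$ for the second largest and the smallest eigenvalue of $(\bar W^t)^\intercal\bar W^t$, where $\bar W^t=\sum_i p_i\,[I_n+(\tilde w^t_i-e_i)e_i^\intercal]$ and $\tilde w^t_i$ is the vector $(\tilde w^t_{j,i})_j$. (For $T\ge1$ this spectral condition at the first iteration entails $s=0$.) Put $\nu=(1-n^{-nB})^{1/B}$ and $$\rho_\nu=\frac{n-1}{n}\Big(\frac{7}{2(1-\rho)}+\frac{\sqrt\rho}{(1-\sqrt\rho)^2}+\frac{384}{1-\nu^2}\Big).$$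 *Algorithm.* SWIFT starts from $x^0_i=x^0$ for all $i$ and runs for $T$ iterations with batch size $M\ge1$ and step size $\gamma=\sqrt{Mn^2\Delta_f}/(\sqrt{TL}+\sqrt M)$. At iteration $t=0,\dots,T-1$, independently of the past, a client $i_t$ is drawn with probabilities $p$, and a batch of $M$ independent samples $\xi^t_m\sim\mathcal D_{i_t}$; then $$x^{t+1}_{i_t}=\sum_k\tilde w^t_{k,i_t}x^t_k-\frac{\gamma}{M}\sum_{m=1}^M\nabla\ell(x^t_{i_t},\xi^t_m),\qquad x^{t+1}_j=x^t_j\ (j\ne i_t).$$ Put $\bar x^t=\frac1n\sum_i x^t_i$. *Claim.* Here $p_{max}=\max_i p_i=1/n$, and the general iteration requirement $T\ge 193^2LM\Delta_f\rho_\nu^2n^4p_{max}^2$ becomes $$T\ge 193^2LM\Delta_f\rho_\nu^2\,n^2,$$ i.e. $T=\Omega(n^2)$. For fixed $L,M,\Delta_f,\rho_\nu$, the right-hand side is, as a function of $n\to\infty$, of smaller order than any requirement growing at least like $n^4$ (the order $T=\Omega(n^4)$ stated for AD-PSGD). Under this weaker requirement the following expectations are finite and $$\frac1T\sum_{t=0}^{T-1}\mathbb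 E\|\nabla f(\bar x^t)\|^2\le\frac{2\sqrt{\Delta_f}}{T}+\frac{2\sqrt{L\Delta_f}\big(1+\frac{1921}{20}\rho_\nu(\sigma^2+6M\zeta^2)\big)}{\sqrt{TM}}\le\frac{C}{\sqrt T},$$ where $C=2\sqrt{\Delta_f}+2\sqrt{L\Delta_f}\,\big(1+\frac{1921}{20}\rho_\nu(\sigma^2+6M\zeta^2)\big)/\sqrt M$. -/

import Mathlib

open MeasureTheory ProbabilityTheory Filter
open scoped BigOperators Gradient Matrix

namespace Swift

/-- The space of models. -/
abbrev Model (d : ℕ) := EuclideanSpace ℝ (Fin d)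

noncomputable section Objectives

variable {n d : ℕ} {Ξ : Type*} [MeasurableSpace Ξ]

/-- Local objective `f_i(x) = E_{ξ ∼ D_i} ℓ(x, ξ)`. -/
def localObjective (ℓ : Model d → Ξ → ℝ) (D : Fin n → Measure Ξ) (i : Fin n) (x : Model d) : ℝ :=
  ∫ ξ, ℓ x ξ ∂(D i)

/-- Global objective `f(x) = ∑ p_i f_i(x)`. -/
def globalObjective (p : Fin n → ℝ) (ℓ : Model d → Ξ → ℝ) (D : Fin n → Measure Ξ)
    (x : Model d) : ℝ :=
  ∑ i, p i * localObjective ℓ D i x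

/-- Gradient of the loss in the model variable. -/
def lossGradient (ℓ : Model d → Ξ → ℝ) (x : Model d) (ξ : Ξ) : Model d :=
  ∇ (fun y => ℓ y ξ) x

/-- The loss is measurable, differentiable in the model, and integrable over the local data, so
that the objectives and the stochastic gradients exist. -/
structure IsLoss (ℓ : Model d → Ξ → ℝ) (D : Fin n → Measure Ξ) : Prop where
  measurable : Measurable (Function.uncurry ℓ)
  differentiable : ∀ ξ, Differentiable ℝ (fun x => ℓ x ξ)
  integrable : ∀ i x, Integrable (ℓ x) (D i)

/-- `h` is differentiable with `L`-Lipschitz gradient. -/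
def IsSmooth (L : ℝ) (h : Model d → ℝ) : Prop :=
  Differentiable ℝ h ∧ ∀ x y, ‖∇ h x - ∇ h y‖ ≤ L * ‖x - y‖

/-- Unbiased stochastic gradients. -/
def UnbiasedGradient (ℓ : Model d → Ξ → ℝ) (D : Fin n → Measure Ξ) : Prop :=
  ∀ i x, Integrable (lossGradient ℓ x) (D i) ∧
    ∫ ξ, lossGradient ℓ x ξ ∂(D i) = ∇ (localObjective ℓ D i) x

/-- Bounded inter-client variance (constant `ζ`, client drawn from `p`) and bounded variance of
the stochastic gradient within each client (constant `σ`). -/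
structure BoundedVariance (p : Fin n → ℝ) (ℓ : Model d → Ξ → ℝ) (D : Fin n → Measure Ξ)
    (σ ζ : ℝ) : Prop where
  inter : ∀ x, ∑ i, p i * ‖∇ (globalObjective p ℓ D) x - ∇ (localObjective ℓ D i) x‖ ^ 2 ≤ ζ ^ 2
  intra_integrable : ∀ i x,
    Integrable (fun ξ => ‖∇ (localObjective ℓ D i) x - lossGradient ℓ x ξ‖ ^ 2) (D i)
  intra : ∀ i x, ∫ ξ, ‖∇ (localObjective ℓ D i) x - lossGradient ℓ x ξ‖ ^ 2 ∂(D i) ≤ σ ^ 2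

end Objectives

noncomputable section Communication

variable {n : ℕ}

/-- Communication set `C_s = {t : t mod (s+1) = 0, t ≤ T}`. -/
def commSet (s T : ℕ) : Set ℕ := {t | t % (s + 1) = 0 ∧ t ≤ T}

/-- Local update counters after the first `t` iterations, `a r` being the client which is active
at iteration `r`: all start at `1`, and the counter of the active client is increased. -/
def counter (a : ℕ → Fin n) : ℕ → Fin n → ℕ
  | 0 => fun _ => 1
  | t + 1 => Function.update (counter a t) (a t) (counter a t (a t) + 1)

/-- The weights `w j i` (weight given by client `i` to the model of client `j`) are client
communication coefficients for the graph `G`: nonnegative, supported on the closed neighbourhoods,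
with columns summing to one and diagonal at least `1 / n`. -/
structure IsCommWeights (G : SimpleGraph (Fin n)) (w : Fin n → Fin n → ℝ) : Prop where
  nonneg : ∀ j i, 0 ≤ w j i
  support : ∀ j i, w j i ≠ 0 → j = i ∨ G.Adj j i
  sum_eq_one : ∀ i, ∑ j, w j i = 1
  diag : ∀ i, 1 / (n : ℝ) ≤ w i i

open Classical in
/-- The coefficients in force at iteration `t`: those of `w t` for a client whose counter lies in
the communication set, those of no averaging for the others. -/
def activeCoeff (w : ℕ → Fin n → Fin n → ℝ) (s T : ℕ) (a : ℕ → Fin n) (t : ℕ)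
    (j i : Fin n) : ℝ :=
  if counter a t i ∈ commSet s T then w t j i else if j = i then 1 else 0

/-- Client communication matrix `I + (w_i - e_i) e_iᵀ` if client `i` is active. -/
def commMatrix (w : Fin n → Fin n → ℝ) (i : Fin n) : Matrix (Fin n) (Fin n) ℝ :=
  1 + Matrix.vecMulVec ((fun j => w j i) - Pi.single i 1) (Pi.single i 1)

/-- Expected client communication matrix `∑ p_i (I + (w_i - e_i) e_iᵀ)`. -/
def expectedCommMatrix (p : Fin n → ℝ) (w : Fin n → Fin n → ℝ) : Matrix (Fin n) (Fin n) ℝ :=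
  ∑ i, p i • commMatrix w i

/-- The `k`-th eigenvalue (counted from `0`, in decreasing order and with multiplicity) of the
real symmetric matrix `Aᵀ A`. -/
def gramEigenvalue (A : Matrix (Fin n) (Fin n) ℝ) (k : Fin n) : ℝ :=
  (show (Aᵀ * A).IsHermitian from Matrix.isHermitian_conjTranspose_mul_self A).eigenvalues₀
    (Fin.cast (Fintype.card_fin n).symm k)

/-- Uniform (`B`-)connectivity: over each window of `B` successive iterations the union of the
communication graphs is connected. -/
def UniformlyConnected (G : ℕ → SimpleGraph (Fin n)) (B : ℕ) : Prop :=
  0 < B ∧ ∀ k : ℕ, (⨆ t ∈ Set.Ico (k * B) ((k + 1) * B), G t).Connected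

/-- `ν = (1 - 1 / n^{nB})^{1/B}`. -/
def nu (n B : ℕ) : ℝ := (1 - 1 / (n : ℝ) ^ (n * B)) ^ (1 / (B : ℝ))

/-- The connectivity constant `ρ_ν`. -/
def rhoNu (n : ℕ) (ρ ν : ℝ) : ℝ :=
  ((n : ℝ) - 1) / n *
    (7 / (2 * (1 - ρ)) + √ρ / (1 - √ρ) ^ 2 + 384 / (1 - ν ^ 2))

end Communication

noncomputable section Algorithm

variable {n d M : ℕ} {Ξ : Type*}

/-- Mini-batch gradient `(1/M) ∑ ∇ℓ(x, ξ_m)`. -/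
def batchGradient (ℓ : Model d → Ξ → ℝ) (x : Model d) (ξ : Fin M → Ξ) : Model d :=
  (1 / (M : ℝ)) • ∑ m, lossGradient ℓ x (ξ m)

open Classical in
/-- The local models of SWIFT, for the activation sequence `a` and the mini-batches `b`. At
iteration `t` the active client `a t` averages the models of its neighbours if its counter lies in
the communication set, then takes a gradient step with the gradient computed at its model before
averaging; the other clients keep their models. -/
def models (ℓ : Model d → Ξ → ℝ) (w : ℕ → Fin n → Fin n → ℝ) (s T : ℕ) (γ : ℝ) (x0 : Model d)
    (a : ℕ → Fin n) (b : ℕ → Fin M → Ξ) : ℕ → Fin n → Model d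
  | 0 => fun _ => x0
  | t + 1 =>
    let x := models ℓ w s T γ x0 a b t
    let i := a t
    let half : Model d := if counter a t i ∈ commSet s T then ∑ k, w t k i • x k else x i
    Function.update x i (half - γ • batchGradient ℓ (x i) (b t))

/-- Average of the local models. -/
def average (x : Fin n → Model d) : Model d := (1 / (n : ℝ)) • ∑ i, x i

/-- Step size `√(M n² Δ) / (√(T L) + √M)`. -/
def stepSize (n M T : ℕ) (L Δ : ℝ) : ℝ :=
  √(M * (n : ℝ) ^ 2 * Δ) / (√(T * L) + √M)

/-- Number of iterations required of SWIFT for `n` clients with maximal influence `pmax`. -/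
def iterationRequirement (L M Δ r n pmax : ℝ) : ℝ :=
  193 ^ 2 * L * M * Δ * r ^ 2 * n ^ 4 * pmax ^ 2

variable [MeasurableSpace Ξ]

/-- Joint law of the active client and its mini-batch: the client is drawn from `p`, and given that
it is `i`, the batch consists of `M` independent samples of `D i`. -/
def stepLaw (M : ℕ) (p : Fin n → ℝ) (D : Fin n → Measure Ξ) : Measure (Fin n × (Fin M → Ξ)) :=
  ∑ i, ENNReal.ofReal (p i) • (Measure.dirac i).prod (Measure.pi fun _ : Fin M => D i)

/-- The active clients `act t` and their mini-batches `data t` are drawn as in SWIFT: independently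
over the iterations, and at each iteration with law `stepLaw`. -/
structure IsSampling {Ω : Type*} [MeasurableSpace Ω] (μ : Measure Ω) (p : Fin n → ℝ)
    (D : Fin n → Measure Ξ) (act : ℕ → Ω → Fin n) (data : ℕ → Ω → Fin M → Ξ) : Prop where
  measurable_act : ∀ t, Measurable (act t)
  measurable_data : ∀ t, Measurable (data t)
  indep : iIndepFun (fun t ω => (act t ω, data t ω)) μ
  law : ∀ t, μ.map (fun ω => (act t ω, data t ω)) = stepLaw M p D

end Algorithm

end Swift

namespace Swift

/-! The proof is a drift estimate for the Lyapunov function Φ(x) = f(x̄) - f(x*) + βV(x), where V is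
the sum of squared distances to the average (`dispersion`), β = 5L/(n²κ) and κ = 1 - √ρ.

Mixing. The spectral condition at the first iteration forces s = 0, so the active client always
averages. Uniform influence makes the coefficient matrix W symmetric and doubly stochastic, and the
expected matrix is I + (W - I)/n. The second eigenvalue bound gives ⟨z, (I - W)z⟩ ≥ nκ|z|² for
zero-sum z, while the diagonal bound 1/n gives |z|² - |Wz|² ≥ (2/n)⟨z, (I - W)z⟩. The factors n
cancel: averaging by all clients at once contracts V by 1 - 2κ (`sum_sq_average_le`), and since one
uniformly drawn client moves, an iteration removes a share of order κ/n from V in expectation.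

Drift. The average moves in expectation by -γ/n times the mean of the local gradients at the local
models, whose squared distance to ∇f(x̄) is at most L²V/n. For γL ≤ 2κ²/193 and γLn ≤ 1/2 the
contraction of V pays for all errors, so that Φ decreases in expectation by γ/(2n) |∇f(x̄)|², up to
a noise term of order Lγ²/(n²κ²) (`lintegral_potential_averagedStep_le`). Independence of the inputs
allows telescoping (`lintegral_iterates_add_sum_le`), and the step size balances the two
contributions (`averaged_bound`).

Constants. Only 1/κ² ≤ 2ρ_ν and 96n² ≤ ρ_ν are needed (`rhoNu_bounds`). The iteration requirement
amounts to γL ≤ 1/(193ρ_ν), from which both smallness conditions follow. -/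

/-- If a symmetric operator fixes `e` and its second eigenvalue is at most `ρ < 1`, then its
quadratic form is bounded by `ρ` on the orthogonal complement of `e`. -/
theorem inner_le_of_second_eigenvalue_le {E : Type*} [NormedAddCommGroup E]
    [InnerProductSpace ℝ E] [FiniteDimensional ℝ E] {S : E →ₗ[ℝ] E} (hS : S.IsSymmetric) {N : ℕ}
    (hN : Module.finrank ℝ E = N) (k : Fin N) (hk : (k : ℕ) = 1) {ρ : ℝ} (hρ1 : ρ < 1)
    (hρ : hS.eigenvalues hN k ≤ ρ) {e : E} (he0 : e ≠ 0) (he : S e = e) {x : E}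
    (hx : inner ℝ e x = 0) : inner ℝ x (S x) ≤ ρ * ‖x‖ ^ 2 := by
  set b := hS.eigenvectorBasis hN with hb
  have hSb : ∀ j, S (b j) = hS.eigenvalues hN j • b j := fun j => by
    exact hS.apply_eigenvectorBasis hN j
  have hle : ∀ j : Fin N, (j : ℕ) ≠ 0 → hS.eigenvalues hN j ≤ ρ := fun j hj =>
    (hS.eigenvalues_antitone hN (by rw [Fin.le_def]; omega : k ≤ j)).trans hρ
  -- `e` has eigenvalue 1 while every eigenvalue but the largest is at most ρ < 1, so `e` is
  -- orthogonal to all other eigenvectors. Hence `e` is a multiple of `b z`, and `x` has no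
  -- component along `b z`.
  have heb : ∀ j : Fin N, (j : ℕ) ≠ 0 → inner ℝ (b j) e = 0 := fun j hj => by
    have h1 : inner ℝ (b j) e = hS.eigenvalues hN j * inner ℝ (b j) e := by
      conv_lhs => rw [← he, ← hS (b j) e, hSb, real_inner_smul_left]
    have h2 := hle j hj
    have h3 : (1 - hS.eigenvalues hN j) * inner ℝ (b j) e = 0 := by linarith
    rcases mul_eq_zero.1 h3 with h | h
    · linarith
    · exact h
  let z : Fin N := ⟨0, by have := k.2; omega⟩
  have hz : ∀ j : Fin N, j ≠ z → (j : ℕ) ≠ 0 := fun j hj h => hj (Fin.ext h)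
  have hesum : e = inner ℝ (b z) e • b z := by
    conv_lhs => rw [← b.sum_repr' e]
    exact Finset.sum_eq_single z (fun j _ hj => by rw [heb j (hz j hj), zero_smul])
      (fun h => absurd (Finset.mem_univ _) h)
  have hbz : inner ℝ (b z) x = 0 := by
    have h1 : inner ℝ (b z) e * inner ℝ (b z) x = 0 := by
      rw [← real_inner_smul_left, ← hesum, hx]
    rcases mul_eq_zero.1 h1 with h | h
    · rw [h, zero_smul] at hesum
      exact absurd hesum he0
    · exact h
  have hx2 : ‖x‖ ^ 2 = ∑ j, inner ℝ (b j) x ^ 2 := by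
    rw [← b.sum_sq_norm_inner_right x]
    simp
  have hxS : inner ℝ x (S x) = ∑ j, hS.eigenvalues hN j * inner ℝ (b j) x ^ 2 := by
    rw [← b.sum_inner_mul_inner x (S x)]
    refine Finset.sum_congr rfl fun j _ => ?_
    rw [← hS (b j) x, hSb, real_inner_smul_left, real_inner_comm]
    ring
  rw [hx2, hxS, Finset.mul_sum]
  refine Finset.sum_le_sum fun j _ => ?_
  by_cases hj : j = z
  · rw [hj, hbz]; simp
  · exact mul_le_mul_of_nonneg_right (hle j (hz j hj)) (sq_nonneg _)

/-! ### Contraction of averaging from the spectral gap -/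

section Mixing

variable {n : ℕ}

/-- The second eigenvalue of `Aᵀ A` bounds `A` on vectors of zero sum. -/
theorem sum_sq_mulVec_le_of_gramEigenvalue_le (hn : 2 ≤ n) (A : Matrix (Fin n) (Fin n) ℝ)
    {ρ : ℝ} (hρ1 : ρ < 1) (hρ : gramEigenvalue A ⟨1, by omega⟩ ≤ ρ)
    (hA : (Aᵀ * A) *ᵥ (fun _ => 1) = fun _ => 1) (z : Fin n → ℝ) (hz : ∑ i, z i = 0) :
    ∑ i, (A *ᵥ z) i ^ 2 ≤ ρ * ∑ i, z i ^ 2 := by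
  have hH : (Aᵀ * A).IsHermitian := Matrix.isHermitian_conjTranspose_mul_self A
  have hS := Matrix.isSymmetric_toEuclideanLin_iff.mpr hH
  have h := inner_le_of_second_eigenvalue_le hS finrank_euclideanSpace
    (Fin.cast (Fintype.card_fin n).symm ⟨1, by omega⟩) rfl hρ1 hρ
    (e := WithLp.toLp 2 (fun _ => (1 : ℝ))) (x := WithLp.toLp 2 z) ?_ ?_ ?_
  · rw [EuclideanSpace.norm_sq_eq] at h
    simp only [Real.norm_eq_abs, sq_abs] at h
    refine le_trans (le_of_eq ?_) h
    rw [Matrix.toLpLin_toLp, EuclideanSpace.inner_toLp_toLp]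
    simp only [star_trivial]
    rw [dotProduct_comm]
    have : z ⬝ᵥ ((Aᵀ * A) *ᵥ z) = (A *ᵥ z) ⬝ᵥ (A *ᵥ z) := by
      rw [← Matrix.mulVec_mulVec, Matrix.dotProduct_mulVec, Matrix.vecMul_transpose]
    rw [Matrix.toLin'_apply, this]
    simp [dotProduct, sq]
  · intro h0
    have := congrArg (fun v : EuclideanSpace ℝ (Fin n) => v ⟨0, by omega⟩) h0
    simp at this
  · rw [Matrix.toLpLin_toLp, Matrix.toLin'_apply, hA]
  · rw [EuclideanSpace.inner_toLp_toLp]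
    simp [dotProduct, hz]

/-- The identity is the expected matrix when no client averages; its eigenvalue 1 is what the bound
ρ < 1 excludes. -/
theorem gramEigenvalue_one (k : Fin n) : gramEigenvalue (1 : Matrix (Fin n) (Fin n) ℝ) k = 1 := by
  have hH : ((1 : Matrix (Fin n) (Fin n) ℝ)ᵀ * 1).IsHermitian :=
    Matrix.isHermitian_conjTranspose_mul_self 1
  have hS := Matrix.isSymmetric_toEuclideanLin_iff.mpr hH
  have h := hS.apply_eigenvectorBasis finrank_euclideanSpace
    (Fin.cast (Fintype.card_fin n).symm k)
  set v := hS.eigenvectorBasis finrank_euclideanSpace (Fin.cast (Fintype.card_fin n).symm k)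
    with hv
  have hv1 : ‖v‖ = 1 := (hS.eigenvectorBasis finrank_euclideanSpace).orthonormal.1 _
  have h2 : Matrix.toEuclideanLin ((1 : Matrix (Fin n) (Fin n) ℝ)ᵀ * 1) v = v := by
    simp
  rw [h2] at h
  have h3 := congrArg (fun u => inner ℝ v u) h
  simp only [RCLike.ofReal_real_eq_id, id, real_inner_smul_right, real_inner_self_eq_norm_sq,
    hv1] at h3
  have : gramEigenvalue (1 : Matrix (Fin n) (Fin n) ℝ) k
    = hS.eigenvalues finrank_euclideanSpace (Fin.cast (Fintype.card_fin n).symm k) := rfl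
  rw [this]; linarith

theorem commMatrix_mulVec (w : Fin n → Fin n → ℝ) (i : Fin n) (z : Fin n → ℝ) (j : Fin n) :
    (commMatrix w i *ᵥ z) j = z j + (w j i - if j = i then 1 else 0) * z i := by
  simp [commMatrix, Matrix.add_mulVec, Matrix.vecMulVec_mulVec, Pi.single_apply, mul_comm]

theorem expectedCommMatrix_mulVec {p : Fin n → ℝ} (hn : 2 ≤ n) (hp : ∀ i, p i = 1 / (n : ℝ))
    (w : Fin n → Fin n → ℝ) (z : Fin n → ℝ) (j : Fin n) :
    (expectedCommMatrix p w *ᵥ z) j = z j + 1 / n * (∑ i, w j i * z i - z j) := by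
  have hn0 : (n : ℝ) ≠ 0 := by positivity
  rw [expectedCommMatrix, Matrix.sum_mulVec, Finset.sum_apply]
  simp only [hp, Matrix.smul_mulVec, Pi.smul_apply, commMatrix_mulVec, smul_eq_mul]
  rw [← Finset.mul_sum]
  simp only [Finset.sum_add_distrib, sub_mul, Finset.sum_sub_distrib]
  simp
  field_simp

theorem expectedCommMatrix_transpose {p : Fin n → ℝ} (hp : ∀ i, p i = 1 / (n : ℝ))
    {w : Fin n → Fin n → ℝ} (hsymm : ∀ i j, w i j = w j i) :
    (expectedCommMatrix p w)ᵀ = expectedCommMatrix p w := by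
  ext j k
  simp only [expectedCommMatrix, commMatrix, Matrix.transpose_apply, Matrix.sum_apply,
    Matrix.smul_apply, Matrix.add_apply, Matrix.vecMulVec_apply, hp, Pi.sub_apply,
    Pi.single_apply, Matrix.one_apply, smul_eq_mul, ← Finset.mul_sum, Finset.sum_add_distrib]
  congr 2
  · simp [eq_comm]
  · simp [hsymm j k, eq_comm]

theorem expectedCommMatrix_indicator {p : Fin n → ℝ} (hn : 2 ≤ n) (hp : ∀ i, p i = 1 / (n : ℝ)) :
    expectedCommMatrix p (fun j i => if j = i then 1 else 0) = 1 := by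
  refine Matrix.toLin'.injective (LinearMap.ext fun z => funext fun j => ?_)
  rw [Matrix.toLin'_apply, expectedCommMatrix_mulVec hn hp]
  simp

/-- The Dirichlet form of a symmetric matrix with unit row sums. -/
theorem sum_sq_sub_bilin_eq {a : Fin n → Fin n → ℝ} (hsymm : ∀ i j, a i j = a j i)
    (hsum : ∀ i, ∑ j, a i j = 1) (z : Fin n → ℝ) :
    ∑ i, z i ^ 2 - ∑ i, ∑ j, a i j * z i * z j
      = 1 / 2 * ∑ i, ∑ j, a i j * (z i - z j) ^ 2 := by
  have h1 : ∑ i, ∑ j, a i j * z i ^ 2 = ∑ i, z i ^ 2 :=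
    Finset.sum_congr rfl fun i _ => by rw [← Finset.sum_mul, hsum, one_mul]
  have h2 : ∑ i, ∑ j, a i j * z j ^ 2 = ∑ i, z i ^ 2 := by
    rw [Finset.sum_comm, ← h1]
    exact Finset.sum_congr rfl fun i _ => Finset.sum_congr rfl fun j _ => by rw [hsymm]
  have h3 : ∑ i, ∑ j, a i j * (z i - z j) ^ 2
      = ∑ i, ∑ j, a i j * z i ^ 2 + ∑ i, ∑ j, a i j * z j ^ 2
        - 2 * ∑ i, ∑ j, a i j * z i * z j := by
    simp only [Finset.mul_sum, ← Finset.sum_add_distrib, ← Finset.sum_sub_distrib]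
    exact Finset.sum_congr rfl fun i _ => Finset.sum_congr rfl fun j _ => by ring
  rw [h3, h1, h2]; ring

/-- Averaging with a symmetric stochastic matrix whose diagonal is at least `c` decreases the sum
of squares by at least `2 c` times the Dirichlet form. -/
theorem two_mul_dirichlet_le {a : Fin n → Fin n → ℝ} (hsymm : ∀ i j, a i j = a j i)
    (hsum : ∀ i, ∑ j, a i j = 1) (hnn : ∀ i j, 0 ≤ a i j) {c : ℝ} (hdiag : ∀ i, c ≤ a i i)
    (z : Fin n → ℝ) :
    2 * c * (∑ i, z i ^ 2 - ∑ i, ∑ j, a i j * z i * z j)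
      ≤ ∑ i, z i ^ 2 - ∑ i, (∑ j, a i j * z j) ^ 2 := by
  set q : Fin n → Fin n → ℝ := fun i j => ∑ k, a i k * a k j with hq
  have hqs : ∀ i j, q i j = q j i := fun i j =>
    Finset.sum_congr rfl fun k _ => by rw [hsymm i k, hsymm k j]; ring
  have hq1 : ∀ i, ∑ j, q i j = 1 := fun i => by
    simp only [hq]
    rw [Finset.sum_comm, ← hsum i]
    exact Finset.sum_congr rfl fun k _ => by rw [← Finset.mul_sum, hsum, mul_one]
  have hqz : ∑ i, (∑ j, a i j * z j) ^ 2 = ∑ i, ∑ j, q i j * z i * z j := by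
    have h1 : ∀ i, (∑ j, a i j * z j) ^ 2 = ∑ j, ∑ k, a i j * z j * (a i k * z k) := fun i => by
      rw [sq, Finset.sum_mul_sum]
    simp only [h1, hq, Finset.sum_mul]
    rw [Finset.sum_comm]
    refine Finset.sum_congr rfl fun i _ => ?_
    rw [Finset.sum_comm]
    refine Finset.sum_congr rfl fun j _ => Finset.sum_congr rfl fun k _ => ?_
    rw [hsymm i k]; ring
  rw [hqz, sum_sq_sub_bilin_eq hsymm hsum, sum_sq_sub_bilin_eq hqs hq1]
  -- Both sides are now Dirichlet forms, of `a` and of its square `q`, and are compared entrywise.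
  -- For i ≠ j the two-step paths that pause at i or at j already give q i j ≥ (a i i + a j j) a i j
  -- ≥ 2c a i j.
  have : ∀ i j, 2 * c * (a i j * (z i - z j) ^ 2) ≤ q i j * (z i - z j) ^ 2 := by
    intro i j
    by_cases hij : i = j
    · simp [hij]
    rw [← mul_assoc]
    refine mul_le_mul_of_nonneg_right ?_ (sq_nonneg _)
    have h1 : a i i * a i j + a i j * a j j ≤ q i j := by
      rw [← Finset.sum_pair (f := fun k => a i k * a k j) hij]
      exact Finset.sum_le_sum_of_subset_of_nonneg (Finset.subset_univ _)
        fun k _ _ => mul_nonneg (hnn _ _) (hnn _ _)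
    have h2 := mul_le_mul_of_nonneg_right (hdiag i) (hnn i j)
    have h3 := mul_le_mul_of_nonneg_left (hdiag j) (hnn i j)
    linarith
  have h := Finset.sum_le_sum fun i (_ : i ∈ Finset.univ) =>
    Finset.sum_le_sum fun j (_ : j ∈ Finset.univ) => this i j
  simp only [← Finset.mul_sum] at h
  linarith

/-- Contraction of averaging on vectors of zero sum, under the spectral condition on the expected
communication matrix. -/
theorem sum_sq_average_le {p : Fin n → ℝ} (hn : 2 ≤ n) (hp : ∀ i, p i = 1 / (n : ℝ))
    {w : Fin n → Fin n → ℝ} (hsymm : ∀ i j, w i j = w j i) (hsum : ∀ i, ∑ j, w j i = 1)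
    (hnn : ∀ i j, 0 ≤ w i j) (hdiag : ∀ i, 1 / (n : ℝ) ≤ w i i) {ρ : ℝ} (hρ0 : 0 ≤ ρ)
    (hρ1 : ρ < 1) (hρ : gramEigenvalue (expectedCommMatrix p w) ⟨1, by omega⟩ ≤ ρ)
    (z : Fin n → ℝ) (hz : ∑ i, z i = 0) :
    ∑ i, (∑ k, w k i * z k) ^ 2 ≤ (1 - 2 * (1 - √ρ)) * ∑ i, z i ^ 2 := by
  have hn0 : (0 : ℝ) < n := by positivity
  have hsum' : ∀ i, ∑ j, w i j = 1 := fun i => by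
    rw [← hsum i]; exact Finset.sum_congr rfl fun j _ => hsymm i j
  set A := expectedCommMatrix p w with hA
  have hA1 : A *ᵥ (fun _ => 1) = fun _ => 1 := by
    funext j; rw [hA, expectedCommMatrix_mulVec hn hp]; simp [hsum']
  have hAA : (Aᵀ * A) *ᵥ (fun _ => 1) = fun _ => 1 := by
    rw [← Matrix.mulVec_mulVec, hA1, expectedCommMatrix_transpose hp hsymm, hA1]
  have h1 := sum_sq_mulVec_le_of_gramEigenvalue_le hn A hρ1 hρ hAA z hz
  set Z := ∑ i, z i ^ 2 with hZ
  have hZ0 : 0 ≤ Z := Finset.sum_nonneg fun i _ => sq_nonneg _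
  -- Cauchy–Schwarz turns the bound on |Az|² into a bound on the quadratic form of A, at the price
  -- of √ρ.
  have h2 : ∑ i, z i * (A *ᵥ z) i ≤ √ρ * Z := by
    refine le_of_sq_le_sq ?_ (by positivity)
    calc (∑ i, z i * (A *ᵥ z) i) ^ 2 ≤ Z * ∑ i, (A *ᵥ z) i ^ 2 :=
          Finset.sum_mul_sq_le_sq_mul_sq _ _ _
      _ ≤ Z * (ρ * Z) := mul_le_mul_of_nonneg_left h1 hZ0
      _ = (√ρ * Z) ^ 2 := by rw [mul_pow, Real.sq_sqrt hρ0]; ring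
  have h3 : ∑ i, z i * (A *ᵥ z) i = Z + 1 / n * (∑ i, ∑ j, w i j * z i * z j - Z) := by
    simp only [hA, expectedCommMatrix_mulVec hn hp]
    rw [hZ, ← Finset.sum_sub_distrib, Finset.mul_sum, ← Finset.sum_add_distrib]
    refine Finset.sum_congr rfl fun i _ => ?_
    have : ∑ j, w i j * z i * z j = z i * ∑ j, w i j * z j := by
      rw [Finset.mul_sum]; exact Finset.sum_congr rfl fun j _ => by ring
    rw [this]; ring
  have h4 := two_mul_dirichlet_le hsymm hsum' hnn hdiag z
  have h5 : ∑ i, (∑ k, w k i * z k) ^ 2 = ∑ i, (∑ j, w i j * z j) ^ 2 :=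
    Finset.sum_congr rfl fun i _ => by
      congr 1; exact Finset.sum_congr rfl fun j _ => by rw [hsymm]
  rw [h5]
  -- The diagonal bound 1/n matches the factor 1/n in A = I + (W - I)/n, so no power of n is lost.
  have h6 : 2 * (1 / (n : ℝ)) * (Z - ∑ i, ∑ j, w i j * z i * z j)
      = 2 * (Z - ∑ i, z i * (A *ᵥ z) i) := by rw [h3]; ring
  linarith

/-- Contraction of averaging on centred families of models. -/
theorem sum_norm_sq_average_le {d : ℕ} {w : Fin n → Fin n → ℝ} {c : ℝ}
    (h : ∀ z : Fin n → ℝ, ∑ i, z i = 0 →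
      ∑ i, (∑ k, w k i * z k) ^ 2 ≤ c * ∑ i, z i ^ 2)
    (y : Fin n → Model d) (hy : ∑ i, y i = 0) :
    ∑ i, ‖∑ k, w k i • y k‖ ^ 2 ≤ c * ∑ i, ‖y i‖ ^ 2 := by
  simp only [EuclideanSpace.norm_sq_eq, Real.norm_eq_abs, sq_abs]
  rw [Finset.sum_comm, Finset.sum_comm (f := fun i j => (y i) j ^ 2), Finset.mul_sum]
  refine Finset.sum_le_sum fun j _ => ?_
  have := h (fun i => y i j) (by simpa using congrArg (fun v : Model d => v j) hy)
  simpa using this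

end Mixing

/-! ### One-step decrease of the potential -/

section Descent

variable {n d : ℕ}

/-- Quadratic upper bound for functions with Lipschitz gradient. -/
theorem IsSmooth.le_quadratic {L : ℝ} {h : Model d → ℝ} (hs : IsSmooth L h) (x v : Model d) :
    h (x + v) ≤ h x + inner ℝ (∇ h x) v + L / 2 * ‖v‖ ^ 2 := by
  obtain ⟨hd, hL⟩ := hs
  set φ : ℝ → ℝ := fun t => h (x + t • v) - t * inner ℝ (∇ h x) v - L / 2 * t ^ 2 * ‖v‖ ^ 2
    with hφ
  have hderiv : ∀ t, HasDerivAt φ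
      (inner ℝ (∇ h (x + t • v)) v - inner ℝ (∇ h x) v - L * t * ‖v‖ ^ 2) t := by
    intro t
    have h1 : HasDerivAt (fun t : ℝ => x + t • v) v t := by
      simpa using ((hasDerivAt_id t).smul_const v).const_add x
    have h2 := ((hd (x + t • v)).hasGradientAt.hasFDerivAt).comp_hasDerivAt t h1
    have h3 := (h2.sub ((hasDerivAt_id t).mul_const (inner ℝ (∇ h x) v))).sub
      (((hasDerivAt_pow 2 t).const_mul (L / 2)).mul_const (‖v‖ ^ 2))
    refine h3.congr_deriv ?_
    rw [InnerProductSpace.toDual_apply_apply]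
    push_cast
    ring
  have hanti : AntitoneOn φ (Set.Icc 0 1) := by
    refine antitoneOn_of_deriv_nonpos (convex_Icc 0 1)
      (fun t _ => (hderiv t).continuousAt.continuousWithinAt)
      (fun t _ => (hderiv t).differentiableAt.differentiableWithinAt) fun t ht => ?_
    rw [interior_Icc] at ht
    rw [(hderiv t).deriv, ← inner_sub_left]
    have h1 := real_inner_le_norm (∇ h (x + t • v) - ∇ h x) v
    have h2 := hL (x + t • v) x
    rw [add_sub_cancel_left, norm_smul, Real.norm_eq_abs, abs_of_pos ht.1] at h2
    have h3 := mul_le_mul_of_nonneg_right h2 (norm_nonneg v)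
    nlinarith
  have := hanti (Set.left_mem_Icc.2 zero_le_one) (Set.right_mem_Icc.2 zero_le_one) zero_le_one
  simp only [hφ, one_smul, zero_smul, add_zero] at this
  linarith

/-- Sum of the squared distances to the average. -/
noncomputable def dispersion (x : Fin n → Model d) : ℝ := ∑ j, ‖x j - average x‖ ^ 2

theorem sum_sub_average (hn : 2 ≤ n) (x : Fin n → Model d) : ∑ j, (x j - average x) = 0 := by
  have hn0 : (n : ℝ) ≠ 0 := by positivity
  rw [Finset.sum_sub_distrib, Finset.sum_const, Finset.card_univ, Fintype.card_fin, average,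
    ← Nat.cast_smul_eq_nsmul ℝ, smul_smul, mul_one_div_cancel hn0, one_smul, sub_self]

/-- The average minimizes the sum of squared distances. After a step the old average may thus serve
as centre, which leaves the terms of the inactive clients unchanged. -/
theorem dispersion_le (hn : 2 ≤ n) (x : Fin n → Model d) (c : Model d) :
    dispersion x ≤ ∑ j, ‖x j - c‖ ^ 2 := by
  have h : ∀ j, ‖x j - c‖ ^ 2 = ‖x j - average x‖ ^ 2
      + 2 * inner ℝ (x j - average x) (average x - c) + ‖average x - c‖ ^ 2 := fun j => by
    rw [← norm_add_sq_real, sub_add_sub_cancel]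
  simp only [h, Finset.sum_add_distrib, ← Finset.mul_sum, ← sum_inner, sum_sub_average hn,
    inner_zero_left, mul_zero, add_zero]
  exact le_add_of_nonneg_right (Finset.sum_nonneg fun _ _ => sq_nonneg _)

theorem average_update (x : Fin n → Model d) (i : Fin n) (v : Model d) :
    average (Function.update x i (x i + v)) = average x + (1 / (n : ℝ)) • v := by
  rw [average, average, ← smul_add]
  congr 1
  rw [Finset.sum_update_of_mem (Finset.mem_univ i), ← Finset.add_sum_erase _ _ (Finset.mem_univ i),
    Finset.sdiff_singleton_eq_erase]
  abel

theorem norm_sq_sum_le (hn : 2 ≤ n) (y : Fin n → Model d) :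
    ‖(1 / (n : ℝ)) • ∑ i, y i‖ ^ 2 ≤ 1 / n * ∑ i, ‖y i‖ ^ 2 := by
  have hn0 : (0 : ℝ) < n := by positivity
  have h1 : ‖∑ i, y i‖ ^ 2 ≤ n * ∑ i, ‖y i‖ ^ 2 := by
    calc ‖∑ i, y i‖ ^ 2 ≤ (∑ i, ‖y i‖) ^ 2 := by gcongr; exact norm_sum_le _ _
      _ ≤ n * ∑ i, ‖y i‖ ^ 2 := by
        simpa using sq_sum_le_card_mul_sum_sq (s := Finset.univ) (f := fun i => ‖y i‖)
  rw [norm_smul, mul_pow, Real.norm_eq_abs, sq_abs]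
  calc (1 / (n : ℝ)) ^ 2 * ‖∑ i, y i‖ ^ 2 ≤ (1 / (n : ℝ)) ^ 2 * (n * ∑ i, ‖y i‖ ^ 2) := by gcongr
    _ = 1 / n * ∑ i, ‖y i‖ ^ 2 := by field_simp

/-- One step of SWIFT with averaging, the stochastic gradient of the active client `i` being
`g + e`. -/
theorem potential_step_le (hn : 2 ≤ n) {L β γ : ℝ} (hβ : 0 ≤ β) {f : Model d → ℝ}
    (hf : IsSmooth L f) (x : Fin n → Model d) (i : Fin n) (W g e : Model d) :
    f (average (Function.update x i (W - γ • (g + e))))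
        + β * dispersion (Function.update x i (W - γ • (g + e)))
      ≤ (f (average x) + 1 / n * inner ℝ (∇ f (average x)) (W - x i - γ • g)
          + L / (2 * n ^ 2) * ‖W - x i - γ • g‖ ^ 2
          + β * (dispersion x - ‖x i - average x‖ ^ 2 + ‖W - average x - γ • g‖ ^ 2))
        + inner ℝ (-(γ / n) • ∇ f (average x) - (L * γ / n ^ 2) • (W - x i - γ • g)
            - (2 * β * γ) • (W - average x - γ • g)) e
        + γ ^ 2 * (L / (2 * n ^ 2) + β) * ‖e‖ ^ 2 := by
  have hn0 : (n : ℝ) ≠ 0 := by positivity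
  set m := average x with hm
  set s := W - x i - γ • g with hs
  set u := W - m - γ • g with hu
  have hv : W - γ • (g + e) = x i + (s - γ • e) := by rw [hs, smul_add]; abel
  have havg : average (Function.update x i (W - γ • (g + e))) = m + (1 / (n : ℝ)) • (s - γ • e) := by
    rw [hv, average_update]
  have h1 := hf.le_quadratic m ((1 / (n : ℝ)) • (s - γ • e))
  have h2 : dispersion (Function.update x i (W - γ • (g + e)))
      ≤ dispersion x - ‖x i - m‖ ^ 2 + ‖u - γ • e‖ ^ 2 := by
    refine (dispersion_le hn _ m).trans (le_of_eq ?_)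
    rw [dispersion, ← hm, ← Finset.add_sum_erase _ _ (Finset.mem_univ i),
      ← Finset.add_sum_erase _ (fun j => ‖x j - m‖ ^ 2) (Finset.mem_univ i)]
    have h3 : ∑ j ∈ Finset.univ.erase i, ‖Function.update x i (W - γ • (g + e)) j - m‖ ^ 2
        = ∑ j ∈ Finset.univ.erase i, ‖x j - m‖ ^ 2 :=
      Finset.sum_congr rfl fun j hj => by
        rw [Function.update_of_ne (Finset.ne_of_mem_erase hj)]
    have h4 : W - γ • (g + e) - m = u - γ • e := by rw [hu, smul_add]; abel
    rw [h3, Function.update_self, h4]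
    ring
  rw [havg]
  have h5 := mul_le_mul_of_nonneg_left h2 hβ
  refine (add_le_add h1 h5).trans (le_of_eq ?_)
  rw [norm_smul, mul_pow, norm_sub_sq_real s, norm_sub_sq_real u]
  simp only [real_inner_smul_right, real_inner_smul_left, inner_sub_right, inner_sub_left,
    norm_smul, mul_pow, Real.norm_eq_abs, sq_abs]
  field_simp
  ring

/-- Polarization gives -1/2 for ‖a‖², and the usually discarded -‖b‖²/2 yields another -1/4. This
extra quarter later absorbs the global gradient in the second-order terms. -/
theorem inner_le_of_norm_sub_sq_le {a b : Model d} {δ : ℝ} (h : ‖a - b‖ ^ 2 ≤ δ) :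
    -inner ℝ a b ≤ -(3 / 4) * ‖a‖ ^ 2 + δ := by
  have h1 := norm_sub_sq_real a b
  have h2 : ‖a‖ ^ 2 ≤ 2 * ‖b‖ ^ 2 + 2 * ‖a - b‖ ^ 2 := by
    have : ‖a‖ ≤ ‖b‖ + ‖a - b‖ := by
      simpa using norm_add_le b (a - b)
    nlinarith [norm_nonneg a, sq_nonneg (‖b‖ - ‖a - b‖)]
  linarith

theorem norm_sub_sq_le_young {κ : ℝ} (hκ : 0 < κ) (u v : Model d) :
    ‖u - v‖ ^ 2 ≤ (1 + κ) * ‖u‖ ^ 2 + (1 + 1 / κ) * ‖v‖ ^ 2 := by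
  have h1 : ‖u - v‖ ^ 2 ≤ (‖u‖ + ‖v‖) ^ 2 := by gcongr; exact norm_sub_le u v
  have h2 : 0 ≤ κ * (‖u‖ - 1 / κ * ‖v‖) ^ 2 := by positivity
  have h3 : κ * (‖u‖ - 1 / κ * ‖v‖) ^ 2
      = κ * ‖u‖ ^ 2 - 2 * ‖u‖ * ‖v‖ + 1 / κ * ‖v‖ ^ 2 := by field_simp; ring
  nlinarith

theorem norm_add_add_sq_le (a b c : Model d) :
    ‖a + b + c‖ ^ 2 ≤ 3 * ‖a‖ ^ 2 + 3 * ‖b‖ ^ 2 + 3 * ‖c‖ ^ 2 := by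
  have h1 : ‖a + b + c‖ ^ 2 ≤ (‖a‖ + ‖b‖ + ‖c‖) ^ 2 := by gcongr; exact norm_add₃_le
  nlinarith [sq_nonneg (‖a‖ - ‖b‖), sq_nonneg (‖a‖ - ‖c‖), sq_nonneg (‖b‖ - ‖c‖)]

/-- The local gradients at the local models are controlled by the dispersion, the heterogeneity and
the global gradient. -/
theorem sum_norm_sq_gradient_le {L ζ : ℝ} (hn : 2 ≤ n)
    {fi : Fin n → Model d → ℝ} (hfi : ∀ i, IsSmooth L (fi i)) {G : Model d} (x : Fin n → Model d)
    (hζ : 1 / n * ∑ i, ‖G - ∇ (fi i) (average x)‖ ^ 2 ≤ ζ ^ 2) :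
    ∑ i, ‖∇ (fi i) (x i)‖ ^ 2
      ≤ 3 * L ^ 2 * dispersion x + 3 * n * ζ ^ 2 + 3 * n * ‖G‖ ^ 2 := by
  have hn0 : (0 : ℝ) < n := by positivity
  have h1 : ∀ i, ‖∇ (fi i) (x i)‖ ^ 2 ≤ 3 * (L ^ 2 * ‖x i - average x‖ ^ 2)
      + 3 * ‖G - ∇ (fi i) (average x)‖ ^ 2 + 3 * ‖G‖ ^ 2 := fun i => by
    have h2 := norm_add_add_sq_le (∇ (fi i) (x i) - ∇ (fi i) (average x))
      (∇ (fi i) (average x) - G) G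
    rw [sub_add_sub_cancel, sub_add_cancel, norm_sub_rev (∇ (fi i) (average x)) G] at h2
    have h3 : ‖∇ (fi i) (x i) - ∇ (fi i) (average x)‖ ^ 2 ≤ L ^ 2 * ‖x i - average x‖ ^ 2 := by
      rw [← mul_pow]; gcongr; exact (hfi i).2 _ _
    linarith
  have h2 := Finset.sum_le_sum fun i (_ : i ∈ Finset.univ) => h1 i
  simp only [Finset.sum_add_distrib, ← Finset.mul_sum, Finset.sum_const, Finset.card_univ,
    Fintype.card_fin, nsmul_eq_mul] at h2
  have h3 : ∑ i, ‖G - ∇ (fi i) (average x)‖ ^ 2 ≤ n * ζ ^ 2 := by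
    rw [one_div, inv_mul_le_iff₀ hn0] at hζ; exact hζ
  rw [dispersion]
  linarith

/-- Collecting the coefficients of the dispersion, of the squared gradient norm and of the
heterogeneity in the expected decrease of the potential. -/
theorem coefficient_arithmetic {n L γ κ ζ F V D2 G2 P Q R : ℝ} (hn2 : 2 ≤ n) (hL : 0 ≤ L)
    (hγ : 0 ≤ γ) (hκ0 : 0 < κ) (hκ1 : κ ≤ 1) (hγκ : γ * L ≤ 2 * κ ^ 2 / 193)
    (hγn : γ * L * n ≤ 1 / 2) (hV0 : 0 ≤ V) (hG0 : 0 ≤ G2) (hD0 : 0 ≤ D2)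
    (hG : G2 ≤ 3 * L ^ 2 * V + 3 * n * ζ ^ 2 + 3 * n * D2)
    (h1 : P ≤ γ * n * (-(3 / 4) * D2 + L ^ 2 * (1 / n * V)))
    (h2 : Q ≤ 8 * V + 2 * γ ^ 2 * G2) (h3 : R ≤ (1 - κ) * V + 2 / κ * γ ^ 2 * G2) :
    F + 1 / n ^ 2 * P + L / (2 * n ^ 3) * Q + 5 * L / (n ^ 3 * κ) * (n * V - V + R)
      ≤ F + 5 * L / (n ^ 2 * κ) * V - γ / (2 * n) * D2
        + 33 * L * γ ^ 2 / (n ^ 2 * κ ^ 2) * ζ ^ 2 := by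
  have hn0 : 0 < n := by linarith
  have h1' := mul_le_mul_of_nonneg_left h1 (by positivity : (0 : ℝ) ≤ 1 / n ^ 2)
  have h2' := mul_le_mul_of_nonneg_left h2 (by positivity : (0 : ℝ) ≤ L / (2 * n ^ 3))
  have h3' := mul_le_mul_of_nonneg_left h3 (by positivity : (0 : ℝ) ≤ 5 * L / (n ^ 3 * κ))
  -- collecting the coefficients
  set q := γ * L with hq
  have hq0 : 0 ≤ q := mul_nonneg hγ hL
  have hκ2 : (0 : ℝ) < κ ^ 2 := by positivity
  -- `G2` enters with weight 1 from `Q` and 10/κ² from `R`. The constant 33 is 11 times the 3 of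
  -- `hG`.
  have hc : 1 + 10 / κ ^ 2 ≤ 11 / κ ^ 2 := by
    rw [le_div_iff₀ hκ2, add_mul, div_mul_cancel₀ _ hκ2.ne']; nlinarith
  have hGc := mul_le_mul_of_nonneg_left hG
    (by positivity : (0 : ℝ) ≤ L * γ ^ 2 / n ^ 3 * (11 / κ ^ 2))
  have hGc' := mul_le_mul_of_nonneg_right (mul_le_mul_of_nonneg_left hc
    (by positivity : (0 : ℝ) ≤ L * γ ^ 2 / n ^ 3)) hG0
  -- One quarter of the gain γ/n · D2 is spent here, out of three: 4 · 33 · 2/193 < 2 ≤ n.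
  have hcD : 33 * L * γ ^ 2 / (n ^ 2 * κ ^ 2) * D2 ≤ γ / (4 * n) * D2 := by
    refine mul_le_mul_of_nonneg_right ?_ hD0
    rw [div_le_div_iff₀ (by positivity) (by positivity)]
    have e1 : 33 * q * 4 ≤ κ ^ 2 * n := by nlinarith
    have := mul_le_mul_of_nonneg_left e1 (by positivity : 0 ≤ γ * n)
    simp only [hq] at this
    linarith
  -- In units of L/n³ · V the contraction gains 5, whence the 5 in β, and `Q` costs 4. The last unit
  -- pays for the gradient bias, q n ≤ 1/2, and for the share of `V` in `G2`.
  have hcV : (q * n + 33 * q ^ 2 / κ ^ 2) * (L / n ^ 3 * V) ≤ 1 * (L / n ^ 3 * V) := by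
    refine mul_le_mul_of_nonneg_right ?_ (by positivity)
    have : 33 * q ^ 2 / κ ^ 2 ≤ 1 / 2 := by
      rw [div_le_iff₀ hκ2]
      nlinarith
    linarith
  have e1 : 1 / n ^ 2 * (γ * n * (-(3 / 4) * D2 + L ^ 2 * (1 / n * V)))
      = -(3 / 4) * (γ / n * D2) + q * n * (L / n ^ 3 * V) := by
    simp only [hq]; field_simp
  have e2 : L / (2 * n ^ 3) * (8 * V + 2 * γ ^ 2 * G2)
      = 4 * (L / n ^ 3 * V) + L * γ ^ 2 / n ^ 3 * G2 := by
    field_simp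
    ring
  have e3 : 5 * L / (n ^ 3 * κ) * ((1 - κ) * V + 2 / κ * γ ^ 2 * G2)
      = 5 * L / (n ^ 3 * κ) * V - 5 * (L / n ^ 3 * V)
        + L * γ ^ 2 / n ^ 3 * (10 / κ ^ 2) * G2 := by
    field_simp
    ring
  have e4 : 5 * L / (n ^ 3 * κ) * (n * V - V)
      = 5 * L / (n ^ 2 * κ) * V - 5 * L / (n ^ 3 * κ) * V := by field_simp
  have e5 : L * γ ^ 2 / n ^ 3 * (11 / κ ^ 2)
        * (3 * L ^ 2 * V + 3 * n * ζ ^ 2 + 3 * n * D2)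
      = 33 * q ^ 2 / κ ^ 2 * (L / n ^ 3 * V) + 33 * L * γ ^ 2 / (n ^ 2 * κ ^ 2) * ζ ^ 2
        + 33 * L * γ ^ 2 / (n ^ 2 * κ ^ 2) * D2 := by simp only [hq]; field_simp; ring
  have e6 : γ / (2 * n) * D2 = 1 / 2 * (γ / n * D2) := by field_simp
  have e7 : γ / (4 * n) * D2 = 1 / 4 * (γ / n * D2) := by field_simp
  have e8 : L * γ ^ 2 / n ^ 3 * (1 + 10 / κ ^ 2) * G2
    = L * γ ^ 2 / n ^ 3 * G2 + L * γ ^ 2 / n ^ 3 * (10 / κ ^ 2) * G2 := by ring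
  rw [e1] at h1'
  rw [e2] at h2'
  rw [e3] at h3'
  rw [e5] at hGc
  rw [e7] at hcD
  rw [e8] at hGc'
  rw [mul_add (5 * L / (n ^ 3 * κ)), e4, e6]
  linarith

/-- Expected decrease of the potential, without the sampling noise. -/
theorem mean_potential_step_le (hn : 2 ≤ n) {L γ κ ζ : ℝ} (hL : 0 ≤ L) (hγ : 0 ≤ γ) (hκ0 : 0 < κ)
    (hκ1 : κ ≤ 1) (hγκ : γ * L ≤ 2 * κ ^ 2 / 193) (hγn : γ * L * n ≤ 1 / 2)
    {w : Fin n → Fin n → ℝ} (hsum : ∀ i, ∑ j, w j i = 1) (hsum' : ∀ j, ∑ i, w j i = 1)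
    (hw : ∀ y : Fin n → Model d, ∑ i, y i = 0 →
      ∑ i, ‖∑ k, w k i • y k‖ ^ 2 ≤ (1 - 2 * κ) * ∑ i, ‖y i‖ ^ 2)
    {fi : Fin n → Model d → ℝ} (hfi : ∀ i, IsSmooth L (fi i)) {f : Model d → ℝ}
    (hf : ∀ x, ∇ f x = (1 / (n : ℝ)) • ∑ i, ∇ (fi i) x) (x : Fin n → Model d)
    (hζ : 1 / n * ∑ i, ‖∇ f (average x) - ∇ (fi i) (average x)‖ ^ 2 ≤ ζ ^ 2) :
    1 / n * ∑ i, (f (average x)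
        + 1 / n * inner ℝ (∇ f (average x)) (∑ k, w k i • x k - x i - γ • ∇ (fi i) (x i))
        + L / (2 * n ^ 2) * ‖∑ k, w k i • x k - x i - γ • ∇ (fi i) (x i)‖ ^ 2
        + 5 * L / (n ^ 2 * κ) * (dispersion x - ‖x i - average x‖ ^ 2
          + ‖∑ k, w k i • x k - average x - γ • ∇ (fi i) (x i)‖ ^ 2))
      ≤ f (average x) + 5 * L / (n ^ 2 * κ) * dispersion x
        - γ / (2 * n) * ‖∇ f (average x)‖ ^ 2 + 33 * L * γ ^ 2 / (n ^ 2 * κ ^ 2) * ζ ^ 2 := by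
  have hn0 : (0 : ℝ) < n := by positivity
  have hn2 : (2 : ℝ) ≤ n := by exact_mod_cast hn
  set m := average x with hm
  set V := dispersion x with hV
  set D2 := ‖∇ f m‖ ^ 2 with hD2
  set G2 := ∑ i, ‖∇ (fi i) (x i)‖ ^ 2 with hG2
  have hV0 : 0 ≤ V := Finset.sum_nonneg fun _ _ => sq_nonneg _
  have hG0 : 0 ≤ G2 := Finset.sum_nonneg fun _ _ => sq_nonneg _
  have hD0 : 0 ≤ D2 := sq_nonneg _
  set u : Fin n → Model d := fun i => ∑ k, w k i • x k - m with hu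
  have hu' : ∀ i, u i = ∑ k, w k i • (x k - m) := fun i => by
    simp only [hu, smul_sub, Finset.sum_sub_distrib, ← Finset.sum_smul, hsum, one_smul]
  have hS : ∑ i, ‖u i‖ ^ 2 ≤ (1 - 2 * κ) * V := by
    simp only [hu']
    exact hw (fun k => x k - m) (sum_sub_average hn x)
  have hG := sum_norm_sq_gradient_le hn hfi x hζ
  -- the drift of the average
  have h1 : ∑ i, inner ℝ (∇ f m) (∑ k, w k i • x k - x i - γ • ∇ (fi i) (x i))
      ≤ γ * n * (-(3 / 4) * D2 + L ^ 2 * (1 / n * V)) := by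
    -- Unit row sums: averaging does not move the mean in expectation, so the drift comes from the
    -- gradients alone.
    have hz : ∑ i, ∑ k, w k i • x k = ∑ i, x i := by
      rw [Finset.sum_comm]
      exact Finset.sum_congr rfl fun k _ => by rw [← Finset.sum_smul, hsum', one_smul]
    have hb : ‖∇ f m - (1 / (n : ℝ)) • ∑ i, ∇ (fi i) (x i)‖ ^ 2 ≤ L ^ 2 * (1 / n * V) := by
      rw [hf, ← smul_sub, ← Finset.sum_sub_distrib]
      refine (norm_sq_sum_le hn _).trans ?_
      have hi : ∀ i, ‖∇ (fi i) m - ∇ (fi i) (x i)‖ ^ 2 ≤ L ^ 2 * ‖x i - m‖ ^ 2 := fun i => by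
        rw [← mul_pow, norm_sub_rev (x i)]
        exact pow_le_pow_left₀ (norm_nonneg _) ((hfi i).2 _ _) 2
      have h := Finset.sum_le_sum fun i (_ : i ∈ Finset.univ) => hi i
      rw [← Finset.mul_sum] at h
      calc _ ≤ 1 / (n : ℝ) * (L ^ 2 * V) := mul_le_mul_of_nonneg_left h (by positivity)
        _ = _ := by ring
    have hb2 := mul_le_mul_of_nonneg_left (inner_le_of_norm_sub_sq_le hb)
      (mul_nonneg hγ hn0.le)
    rw [← inner_sum, Finset.sum_sub_distrib, Finset.sum_sub_distrib, hz, sub_self, zero_sub,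
      ← Finset.smul_sum, inner_neg_right, real_inner_smul_right]
    rw [real_inner_smul_right] at hb2
    refine le_trans (le_of_eq ?_) hb2
    field_simp
  have h2 : ∑ i, ‖∑ k, w k i • x k - x i - γ • ∇ (fi i) (x i)‖ ^ 2 ≤ 8 * V + 2 * γ ^ 2 * G2 := by
    have : ∀ i, ‖∑ k, w k i • x k - x i - γ • ∇ (fi i) (x i)‖ ^ 2
        ≤ 4 * ‖u i‖ ^ 2 + 4 * ‖x i - m‖ ^ 2 + 2 * γ ^ 2 * ‖∇ (fi i) (x i)‖ ^ 2 := fun i => by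
      have e1 := norm_sub_sq_le_young one_pos (∑ k, w k i • x k - x i) (γ • ∇ (fi i) (x i))
      have e2 := norm_sub_sq_le_young one_pos (u i) (x i - m)
      rw [hu, sub_sub_sub_cancel_right] at e2
      rw [norm_smul, mul_pow, Real.norm_eq_abs, sq_abs] at e1
      norm_num at e1 e2
      linarith
    have h := Finset.sum_le_sum fun i (_ : i ∈ Finset.univ) => this i
    simp only [Finset.sum_add_distrib, ← Finset.mul_sum] at h
    have hVdef : ∑ i, ‖x i - m‖ ^ 2 = V := rfl
    rw [hVdef] at h
    nlinarith [mul_nonneg hκ0.le hV0]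
  have h3 : ∑ i, ‖∑ k, w k i • x k - m - γ • ∇ (fi i) (x i)‖ ^ 2
      ≤ (1 - κ) * V + 2 / κ * γ ^ 2 * G2 := by
    have : ∀ i, ‖∑ k, w k i • x k - m - γ • ∇ (fi i) (x i)‖ ^ 2
        ≤ (1 + κ) * ‖u i‖ ^ 2 + (1 + 1 / κ) * γ ^ 2 * ‖∇ (fi i) (x i)‖ ^ 2 := fun i => by
      -- Young's inequality with parameter κ gives up half of the contraction: (1 + κ)(1 - 2κ) ≤ 1 -
      -- κ.
      have e1 := norm_sub_sq_le_young hκ0 (u i) (γ • ∇ (fi i) (x i))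
      rw [norm_smul, mul_pow, Real.norm_eq_abs, sq_abs, ← mul_assoc] at e1
      exact e1
    have h := Finset.sum_le_sum fun i (_ : i ∈ Finset.univ) => this i
    simp only [Finset.sum_add_distrib, ← Finset.mul_sum] at h
    have e2 : 1 + 1 / κ ≤ 2 / κ := by
      rw [le_div_iff₀ hκ0, add_mul, one_div_mul_cancel hκ0.ne']; linarith
    have e3 := mul_le_mul_of_nonneg_right e2 (mul_nonneg (sq_nonneg γ) hG0)
    have e4 := mul_le_mul_of_nonneg_left hS (by linarith : 0 ≤ 1 + κ)
    have e5 : 0 ≤ κ ^ 2 * V := by positivity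
    nlinarith
  have hsumeq : 1 / (n : ℝ) * ∑ i, (f m
        + 1 / n * inner ℝ (∇ f m) (∑ k, w k i • x k - x i - γ • ∇ (fi i) (x i))
        + L / (2 * n ^ 2) * ‖∑ k, w k i • x k - x i - γ • ∇ (fi i) (x i)‖ ^ 2
        + 5 * L / (n ^ 2 * κ) * (V - ‖x i - m‖ ^ 2
          + ‖∑ k, w k i • x k - m - γ • ∇ (fi i) (x i)‖ ^ 2))
      = f m + 1 / n ^ 2 * (∑ i, inner ℝ (∇ f m) (∑ k, w k i • x k - x i - γ • ∇ (fi i) (x i)))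
        + L / (2 * n ^ 3) * (∑ i, ‖∑ k, w k i • x k - x i - γ • ∇ (fi i) (x i)‖ ^ 2)
        + 5 * L / (n ^ 3 * κ) * (n * V - V
          + ∑ i, ‖∑ k, w k i • x k - m - γ • ∇ (fi i) (x i)‖ ^ 2) := by
    have hVdef : ∑ i, ‖x i - m‖ ^ 2 = V := rfl
    simp only [Finset.sum_add_distrib, Finset.sum_sub_distrib, ← Finset.mul_sum, Finset.sum_const,
      Finset.card_univ, Fintype.card_fin, nsmul_eq_mul, hVdef]
    field_simp
  rw [hsumeq]
  exact coefficient_arithmetic (by exact_mod_cast hn) hL hγ hκ0 hκ1 hγκ hγn hV0 hG0 hD0 hG h1 h2 h3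

end Descent

/-! ### Telescoping along a chain with independent inputs -/

section Chain

/-- Iterates of a sequence of maps driven by the inputs `z`. -/
def iterates {S Z : Type*} (step : ℕ → S → Z → S) (s0 : S) (z : ℕ → Z) : ℕ → S
  | 0 => s0
  | t + 1 => step t (iterates step s0 z t) (z t)

variable {S Z Ω : Type*} [MeasurableSpace S] [MeasurableSpace Z] {step : ℕ → S → Z → S} {s0 : S}
  {ξ : ℕ → Ω → Z}

/-- The σ-algebra matters: the iterate at `t` depends only on inputs before `t`, which gives its
independence from `ξ t`. -/
theorem measurable_iterates_iSup (hstep : ∀ t, Measurable (Function.uncurry (step t))) (t : ℕ) :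
    Measurable[⨆ k ∈ Set.Iio t, MeasurableSpace.comap (ξ k) inferInstance]
      (fun ω => iterates step s0 (fun k => ξ k ω) t) := by
  induction t with
  | zero => exact measurable_const
  | succ t ih =>
    have h1 : Measurable[⨆ k ∈ Set.Iio (t + 1), MeasurableSpace.comap (ξ k) inferInstance]
        (fun ω => iterates step s0 (fun k => ξ k ω) t) :=
      ih.mono (biSup_mono fun k hk => lt_trans hk (Nat.lt_succ_self t)) le_rfl
    have h2 : Measurable[⨆ k ∈ Set.Iio (t + 1), MeasurableSpace.comap (ξ k) inferInstance]
        (ξ t) :=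
      (comap_measurable (ξ t)).mono
        (le_biSup (fun k => MeasurableSpace.comap (ξ k) inferInstance) (Nat.lt_succ_self t)) le_rfl
    exact (hstep t).comp (h1.prodMk h2)

variable [MeasurableSpace Ω]

theorem measurable_iterates (hstep : ∀ t, Measurable (Function.uncurry (step t)))
    (hξ : ∀ t, Measurable (ξ t)) (t : ℕ) :
    Measurable (fun ω => iterates step s0 (fun k => ξ k ω) t) :=
  (measurable_iterates_iSup hstep t).mono (iSup₂_le fun k _ => (hξ k).comap_le) le_rfl

/-- The current iterate is independent of the next input. -/
theorem indepFun_iterates {μ : Measure Ω} (hstep : ∀ t, Measurable (Function.uncurry (step t)))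
    (hξ : ∀ t, Measurable (ξ t)) (hind : iIndepFun ξ μ) (t : ℕ) :
    IndepFun (fun ω => iterates step s0 (fun k => ξ k ω) t) (ξ t) μ := by
  have h := indep_iSup_of_disjoint (fun k => (hξ k).comap_le) hind.iIndep
    (S := Set.Iio t) (T := {t}) (by simp)
  refine indep_of_indep_of_le_left (indep_of_indep_of_le_right h ?_) ?_
  · exact le_biSup (fun k => MeasurableSpace.comap (ξ k) inferInstance) (Set.mem_singleton t)
  · exact (measurable_iterates_iSup hstep t).comap_le

/-- Telescoping of a one-step drift inequality along a chain driven by independent identically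
distributed inputs. -/
theorem lintegral_iterates_add_sum_le {μ : Measure Ω} [IsProbabilityMeasure μ] {law : Measure Z}
    (hstep : ∀ t, Measurable (Function.uncurry (step t))) (hξ : ∀ t, Measurable (ξ t))
    (hind : iIndepFun ξ μ) (hlaw : ∀ t, μ.map (ξ t) = law) {ψ φ : S → ENNReal}
    (hψ : Measurable ψ) (hφ : Measurable φ) {K : ENNReal} {T : ℕ}
    (hdrift : ∀ t < T, ∀ s, ∫⁻ z, ψ (step t s z) ∂law + φ s ≤ ψ s + K) :
    ∫⁻ ω, ψ (iterates step s0 (fun k => ξ k ω) T) ∂μ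
        + ∑ t ∈ Finset.range T, ∫⁻ ω, φ (iterates step s0 (fun k => ξ k ω) t) ∂μ
      ≤ ψ s0 + T * K := by
  have hlawp : IsProbabilityMeasure law := by
    rw [← hlaw 0]; exact Measure.isProbabilityMeasure_map (hξ 0).aemeasurable
  set X : ℕ → Ω → S := fun t ω => iterates step s0 (fun k => ξ k ω) t with hX
  have hXm : ∀ t, Measurable (X t) := measurable_iterates hstep hξ
  have hone : ∀ t < T, ∫⁻ ω, ψ (X (t + 1) ω) ∂μ + ∫⁻ ω, φ (X t ω) ∂μ
      ≤ ∫⁻ ω, ψ (X t ω) ∂μ + K := by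
    intro t ht
    have hm : Measurable (fun q : S × Z => ψ (step t q.1 q.2)) := hψ.comp (hstep t)
    -- By independence the joint law of the state and the new input is a product, so by Tonelli the
    -- input is averaged with the state frozen.
    have h1 : ∫⁻ ω, ψ (X (t + 1) ω) ∂μ
        = ∫⁻ s, ∫⁻ z, ψ (step t s z) ∂law ∂(μ.map (X t)) := by
      have h2 := (indepFun_iterates (s0 := s0) hstep hξ hind t).map_prod_eq_prod_map_map
        (hXm t).aemeasurable (hξ t).aemeasurable
      have hp : IsProbabilityMeasure (μ.map (X t)) :=
        Measure.isProbabilityMeasure_map (hXm t).aemeasurable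
      rw [← lintegral_prod (μ := μ.map (X t)) (ν := law) (fun q => ψ (step t q.1 q.2))
        hm.aemeasurable, ← hlaw t, ← h2, lintegral_map hm ((hXm t).prodMk (hξ t))]
      rfl
    have hm2 : Measurable (fun s => ∫⁻ z, ψ (step t s z) ∂law) := hm.lintegral_prod_right'
    have hφX : Measurable (fun ω => φ (X t ω)) := hφ.comp (hXm t)
    rw [h1, lintegral_map hm2 (hXm t), ← lintegral_add_right _ hφX]
    calc _ ≤ ∫⁻ ω, (ψ (X t ω) + K) ∂μ := lintegral_mono fun ω => hdrift t ht _
      _ = _ := by rw [lintegral_add_right _ measurable_const]; simp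
  have hall : ∀ N ≤ T, ∫⁻ ω, ψ (X N ω) ∂μ + ∑ t ∈ Finset.range N, ∫⁻ ω, φ (X t ω) ∂μ
      ≤ ψ s0 + N * K := by
    intro N hN
    induction N with
    | zero => simp [hX, iterates]
    | succ N ih =>
      rw [Finset.sum_range_succ]
      calc _ = ∑ t ∈ Finset.range N, ∫⁻ ω, φ (X t ω) ∂μ
            + (∫⁻ ω, ψ (X (N + 1) ω) ∂μ + ∫⁻ ω, φ (X N ω) ∂μ) := by ring
        _ ≤ ∑ t ∈ Finset.range N, ∫⁻ ω, φ (X t ω) ∂μ + (∫⁻ ω, ψ (X N ω) ∂μ + K) :=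
          add_le_add le_rfl (hone N hN)
        _ = (∫⁻ ω, ψ (X N ω) ∂μ + ∑ t ∈ Finset.range N, ∫⁻ ω, φ (X t ω) ∂μ) + K := by ring
        _ ≤ (ψ s0 + N * K) + K := add_le_add (ih (by omega)) le_rfl
        _ = _ := by push_cast; ring
  exact hall T le_rfl

end Chain

/-! ### Measurability and variance of stochastic gradients -/

section Noise

variable {n d M : ℕ} {Ξ : Type*} [MeasurableSpace Ξ]

theorem measurable_model_of_coord {α : Type*} [MeasurableSpace α] {g : α → Model d}
    (h : ∀ c, Measurable fun a => g a c) : Measurable g :=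
  (WithLp.measurable_toLp 2 _).comp (measurable_pi_lambda (fun a c => g a c) h)

/-- The gradient of a jointly measurable differentiable loss is jointly measurable. -/
theorem measurable_lossGradient {ℓ : Model d → Ξ → ℝ} (hm : Measurable (Function.uncurry ℓ))
    (hd : ∀ ξ, Differentiable ℝ (fun x => ℓ x ξ)) :
    Measurable (fun q : Model d × Ξ => lossGradient ℓ q.1 q.2) := by
  refine measurable_model_of_coord fun c => ?_
  set v : Model d := EuclideanSpace.single c 1 with hv
  -- Each partial derivative is the limit of difference quotients with increment 1/k; the junk term
  -- k = 0 does not affect the limit.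
  refine measurable_of_tendsto_metrizable
    (f := fun (k : ℕ) (q : Model d × Ξ) =>
      (k : ℝ) * (ℓ (q.1 + (k : ℝ)⁻¹ • v) q.2 - ℓ q.1 q.2)) (fun k => ?_) ?_
  · have h1 : Measurable (fun q : Model d × Ξ => ℓ (q.1 + (k : ℝ)⁻¹ • v) q.2) :=
      hm.comp ((measurable_fst.add_const _).prodMk measurable_snd)
    exact (h1.sub hm).const_mul _
  · rw [tendsto_pi_nhds]
    intro q
    have h1 := (hd q.2 q.1).hasGradientAt.hasFDerivAt.lim v (c := fun k : ℕ => (k : ℝ))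
      (l := atTop) (by simpa using tendsto_natCast_atTop_atTop)
    rw [InnerProductSpace.toDual_apply_apply, hv, EuclideanSpace.inner_single_right] at h1
    simpa [lossGradient] using h1

theorem memLp_coord {α : Type*} [MeasurableSpace α] {ν : Measure α} {Y : α → Model d}
    (hY : MemLp Y 2 ν) (c : Fin d) : MemLp (fun a => Y a c) 2 ν :=
  hY.of_le ((EuclideanSpace.proj (𝕜 := ℝ) c).continuous.comp_aestronglyMeasurable hY.1)
    (Eventually.of_forall fun a => PiLp.norm_apply_le (Y a) c)

/-- Mean and variance of a mini-batch average of centred vectors. -/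
theorem batch_noise (hM : 1 ≤ M) {ν : Measure Ξ} [IsProbabilityMeasure ν] {Y : Ξ → Model d}
    {σ : ℝ} (hY : MemLp Y 2 ν) (hY0 : ∫ ξ, Y ξ ∂ν = 0) (hYσ : ∫ ξ, ‖Y ξ‖ ^ 2 ∂ν ≤ σ ^ 2) :
    MemLp (fun ξ : Fin M → Ξ => (1 / (M : ℝ)) • ∑ m, Y (ξ m)) 2 (Measure.pi fun _ => ν) ∧
    ∫ ξ : Fin M → Ξ, (1 / (M : ℝ)) • ∑ m, Y (ξ m) ∂(Measure.pi fun _ => ν) = 0 ∧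
    ∫ ξ : Fin M → Ξ, ‖(1 / (M : ℝ)) • ∑ m, Y (ξ m)‖ ^ 2 ∂(Measure.pi fun _ => ν)
      ≤ σ ^ 2 / M := by
  have hM0 : (M : ℝ) ≠ 0 := by positivity
  have hev : ∀ m : Fin M, MeasurePreserving (fun ξ : Fin M → Ξ => ξ m)
      (Measure.pi fun _ => ν) ν := fun m => measurePreserving_eval (fun _ => ν) m
  have hm2 : ∀ m : Fin M, MemLp (fun ξ : Fin M → Ξ => Y (ξ m)) 2 (Measure.pi fun _ => ν) :=
    fun m => hY.comp_measurePreserving (hev m)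
  have he : MemLp (fun ξ : Fin M → Ξ => (1 / (M : ℝ)) • ∑ m, Y (ξ m)) 2
      (Measure.pi fun _ => ν) :=
    (memLp_finsetSum Finset.univ fun m _ => hm2 m).const_smul (1 / (M : ℝ))
  have he0 : ∫ ξ : Fin M → Ξ, (1 / (M : ℝ)) • ∑ m, Y (ξ m) ∂(Measure.pi fun _ => ν) = 0 := by
    rw [integral_smul, integral_finsetSum _ fun m _ => (hm2 m).integrable one_le_two]
    have : ∀ m : Fin M, ∫ ξ : Fin M → Ξ, Y (ξ m) ∂(Measure.pi fun _ => ν) = 0 := fun m => by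
      rw [← integral_map (f := Y) (hev m).measurable.aemeasurable
        (by rw [(hev m).map_eq]; exact hY.1), (hev m).map_eq, hY0]
    simp [this]
  refine ⟨he, he0, ?_⟩
  have hcoord0 : ∀ {α : Type _} [MeasurableSpace α] {κ : Measure α} {g : α → Model d},
      Integrable g κ → ∫ a, g a ∂κ = 0 → ∀ c, ∫ a, g a c ∂κ = 0 := fun hg h0 c => by
    have := (EuclideanSpace.proj (𝕜 := ℝ) c : Model d →L[ℝ] ℝ).integral_comp_comm hg
    rw [h0] at this
    simpa using this
  -- In each coordinate the variances of the M independent samples add up, and M · (1/M)² = 1/M.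
  have hc : ∀ c : Fin d,
      ∫ ξ : Fin M → Ξ, ((1 / (M : ℝ)) • ∑ m, Y (ξ m)) c ^ 2 ∂(Measure.pi fun _ => ν)
        = 1 / M * ∫ ξ, Y ξ c ^ 2 ∂ν := by
    intro c
    rw [← variance_of_integral_eq_zero (memLp_coord he c).1.aemeasurable
        (hcoord0 (he.integrable one_le_two) he0 c),
      ← variance_of_integral_eq_zero (memLp_coord hY c).1.aemeasurable
        (hcoord0 (hY.integrable one_le_two) hY0 c)]
    have h1 := variance_sum_pi (μ := fun _ : Fin M => ν) (X := fun _ ξ => Y ξ c)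
      fun _ => memLp_coord hY c
    have h2 : (fun ξ : Fin M → Ξ => ((1 / (M : ℝ)) • ∑ m, Y (ξ m)) c)
        = fun ξ => (1 / (M : ℝ)) * (∑ m, fun ξ : Fin M → Ξ => Y (ξ m) c) ξ := by
      funext ξ; simp
    rw [h2, variance_const_mul, h1]
    simp
    field_simp
  have hsq : ∀ {α : Type _} [MeasurableSpace α] {κ : Measure α} {g : α → Model d},
      MemLp g 2 κ → ∫ a, ‖g a‖ ^ 2 ∂κ = ∑ c, ∫ a, g a c ^ 2 ∂κ := fun hg => by
    rw [← integral_finsetSum _ fun c _ => (memLp_coord hg c).integrable_sq]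
    simp [EuclideanSpace.norm_sq_eq]
  rw [hsq he]
  simp only [hc]
  rw [← Finset.mul_sum, ← hsq hY, one_div_mul_eq_div]
  exact div_le_div_of_nonneg_right hYσ (Nat.cast_nonneg M)

/-- Expectation of a nonnegative function dominated by a quadratic function of centred noise. -/
theorem lintegral_ofReal_le_of_le_quadratic {α : Type*} [MeasurableSpace α] {κ : Measure α}
    [IsProbabilityMeasure κ] {e : α → Model d} {v : ℝ} (he : MemLp e 2 κ) (he0 : ∫ a, e a ∂κ = 0)
    (hev : ∫ a, ‖e a‖ ^ 2 ∂κ ≤ v) {h : α → ℝ} (h0 : ∀ a, 0 ≤ h a) {A C : ℝ} {b : Model d}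
    (hC : 0 ≤ C) (hle : ∀ a, h a ≤ A + inner ℝ b (e a) + C * ‖e a‖ ^ 2) :
    0 ≤ A + C * v ∧ ∫⁻ a, ENNReal.ofReal (h a) ∂κ ≤ ENNReal.ofReal (A + C * v) := by
  have hi1 : Integrable (fun a => inner ℝ b (e a)) κ := (he.integrable one_le_two).const_inner b
  have hi2 : Integrable (fun a => C * ‖e a‖ ^ 2) κ := he.norm.integrable_sq.const_mul C
  have hi3 : Integrable (fun a => A + inner ℝ b (e a)) κ := (integrable_const A).add hi1
  have hq : ∫ a, (A + inner ℝ b (e a) + C * ‖e a‖ ^ 2) ∂κ ≤ A + C * v := by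
    rw [integral_add hi3 hi2, integral_add (integrable_const A) hi1,
      integral_inner (he.integrable one_le_two), he0, integral_const_mul]
    simp only [integral_const, probReal_univ, one_smul, inner_zero_right, add_zero]
    gcongr
  have hq0 : ∀ a, 0 ≤ A + inner ℝ b (e a) + C * ‖e a‖ ^ 2 := fun a => (h0 a).trans (hle a)
  refine ⟨(integral_nonneg hq0).trans hq, ?_⟩
  calc ∫⁻ a, ENNReal.ofReal (h a) ∂κ
      ≤ ∫⁻ a, ENNReal.ofReal (A + inner ℝ b (e a) + C * ‖e a‖ ^ 2) ∂κ :=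
        lintegral_mono fun a => ENNReal.ofReal_le_ofReal (hle a)
    _ = ENNReal.ofReal (∫ a, (A + inner ℝ b (e a) + C * ‖e a‖ ^ 2) ∂κ) :=
        (ofReal_integral_eq_lintegral_ofReal (hi3.add hi2) (Eventually.of_forall hq0)).symm
    _ ≤ _ := ENNReal.ofReal_le_ofReal hq

theorem lintegral_stepLaw (p : Fin n → ℝ) (D : Fin n → Measure Ξ) [∀ i, IsProbabilityMeasure (D i)]
    {F : Fin n × (Fin M → Ξ) → ENNReal} (hF : Measurable F) :
    ∫⁻ z, F z ∂(stepLaw M p D)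
      = ∑ i, ENNReal.ofReal (p i) * ∫⁻ ξ, F (i, ξ) ∂(Measure.pi fun _ : Fin M => D i) := by
  rw [stepLaw, lintegral_finsetSum_measure]
  refine Finset.sum_congr rfl fun i _ => ?_
  rw [lintegral_smul_measure, Measure.dirac_prod, lintegral_map hF measurable_prodMk_left,
    smul_eq_mul]

end Noise

/-! ### SWIFT as a Markov chain, and its expected drift -/

section Reduction

variable {n d M : ℕ} {Ξ : Type*}

/-- One iteration of SWIFT in which the active client averages. -/
noncomputable def averagedStep (ℓ : Model d → Ξ → ℝ) (w : Fin n → Fin n → ℝ) (γ : ℝ)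
    (x : Fin n → Model d) (z : Fin n × (Fin M → Ξ)) : Fin n → Model d :=
  Function.update x z.1 (∑ k, w k z.1 • x k - γ • batchGradient ℓ (x z.1) z.2)

theorem counter_le_succ (a : ℕ → Fin n) (t : ℕ) (i : Fin n) : counter a t i ≤ t + 1 := by
  induction t generalizing i with
  | zero => simp [counter]
  | succ t ih =>
    rw [counter]
    by_cases h : i = a t
    · subst h; rw [Function.update_self]; have := ih (a t); omega
    · rw [Function.update_of_ne h]; have := ih i; omega

/-- Counters start at 1 and grow by at most one, so before iteration `T` the cap `c ≤ T` excludes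
nothing. -/
theorem counter_mem_commSet_zero {T t : ℕ} (ht : t < T) (a : ℕ → Fin n) (i : Fin n) :
    counter a t i ∈ commSet 0 T :=
  ⟨Nat.mod_one _, (counter_le_succ a t i).trans ht⟩

theorem activeCoeff_zero (w : ℕ → Fin n → Fin n → ℝ) {T t : ℕ} (ht : t < T) (a : ℕ → Fin n) :
    activeCoeff w 0 T a t = w t := by
  funext j i
  rw [activeCoeff, if_pos (counter_mem_commSet_zero ht a i)]

/-- The spectral condition at the first iteration forces averaging at every iteration. -/
theorem eq_zero_of_gramEigenvalue_lt_one {p : Fin n → ℝ} (hn : 2 ≤ n)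
    (hp : ∀ i, p i = 1 / (n : ℝ)) {w : ℕ → Fin n → Fin n → ℝ} {s T : ℕ} {a : ℕ → Fin n}
    {k : Fin n} (h : gramEigenvalue (expectedCommMatrix p (activeCoeff w s T a 0)) k < 1) :
    s = 0 := by
  by_contra hs
  have h1 : activeCoeff w s T a 0 = fun j i => if j = i then 1 else 0 := by
    funext j i
    rw [activeCoeff, if_neg]
    -- At iteration 0 every counter is 1, which s + 1 does not divide when s ≥ 1: no client would
    -- average.
    rintro ⟨h2, -⟩
    change 1 % (s + 1) = 0 at h2
    rw [Nat.mod_eq_of_lt (by omega)] at h2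
    exact one_ne_zero h2
  rw [h1, expectedCommMatrix_indicator hn hp, gramEigenvalue_one] at h
  exact lt_irrefl _ h

theorem models_eq_iterates (ℓ : Model d → Ξ → ℝ) (w : ℕ → Fin n → Fin n → ℝ) {T : ℕ} (γ : ℝ)
    (x0 : Model d) (a : ℕ → Fin n) (b : ℕ → Fin M → Ξ) {t : ℕ} (ht : t ≤ T) :
    models ℓ w 0 T γ x0 a b t
      = iterates (fun t => averagedStep ℓ (w t) γ) (fun _ => x0) (fun k => (a k, b k)) t := by
  induction t with
  | zero => rfl
  | succ t ih =>
    rw [models, iterates, ← ih (by omega)]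
    simp only [if_pos (counter_mem_commSet_zero ht a (a t)), averagedStep]

/-- Serves the case Δ = 0, where the step size vanishes; averaging equal models changes nothing. -/
theorem models_of_stepSize_zero (ℓ : Model d → Ξ → ℝ) {w : ℕ → Fin n → Fin n → ℝ}
    (hw : ∀ t i, ∑ j, w t j i = 1) (s T : ℕ) (x0 : Model d) (a : ℕ → Fin n)
    (b : ℕ → Fin M → Ξ) (t : ℕ) : models ℓ w s T 0 x0 a b t = fun _ => x0 := by
  induction t with
  | zero => rfl
  | succ t ih =>
    rw [models]
    simp only [ih, ← Finset.sum_smul, hw, one_smul, ite_self, zero_smul, sub_zero]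
    exact Function.update_eq_self (a t) _

theorem average_const (hn : 2 ≤ n) (x : Model d) : average (fun _ : Fin n => x) = x := by
  have hn0 : (n : ℝ) ≠ 0 := by positivity
  rw [average, Finset.sum_const, Finset.card_univ, Fintype.card_fin, ← Nat.cast_smul_eq_nsmul ℝ,
    smul_smul, one_div_mul_cancel hn0, one_smul]

theorem measurable_average : Measurable (average : (Fin n → Model d) → Model d) := by
  unfold average
  fun_prop

theorem measurable_dispersion : Measurable (dispersion : (Fin n → Model d) → ℝ) := by
  unfold dispersion
  have := measurable_average (n := n) (d := d)
  fun_prop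

variable [MeasurableSpace Ξ]

theorem measurable_averagedStep {ℓ : Model d → Ξ → ℝ} (hm : Measurable (Function.uncurry ℓ))
    (hd : ∀ ξ, Differentiable ℝ (fun x => ℓ x ξ)) (w : Fin n → Fin n → ℝ) (γ : ℝ) :
    Measurable (Function.uncurry (averagedStep (M := M) ℓ w γ)) := by
  have hi : ∀ i, Measurable (fun q : (Fin n → Model d) × (Fin M → Ξ) =>
      averagedStep ℓ w γ q.1 (i, q.2)) := by
    intro i
    have hg : ∀ m, Measurable (fun q : (Fin n → Model d) × (Fin M → Ξ) =>
        lossGradient ℓ (q.1 i) (q.2 m)) := fun m =>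
      (measurable_lossGradient hm hd).comp
        (g := fun q : Model d × Ξ => lossGradient ℓ q.1 q.2)
        (f := fun q : (Fin n → Model d) × (Fin M → Ξ) => (q.1 i, q.2 m)) (by fun_prop)
    have hv : Measurable (fun q : (Fin n → Model d) × (Fin M → Ξ) =>
        ∑ k, w k i • q.1 k - γ • batchGradient ℓ (q.1 i) q.2) := by
      unfold batchGradient
      fun_prop
    exact measurable_update'.comp (measurable_fst.prodMk hv)
  have h2 : Measurable (fun q : ((Fin n → Model d) × (Fin M → Ξ)) × Fin n =>
      averagedStep ℓ w γ q.1.1 (q.2, q.1.2)) := measurable_from_prod_countable_left hi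
  exact h2.comp ((measurable_fst.prodMk (measurable_snd.comp measurable_snd)).prodMk
    (measurable_fst.comp measurable_snd))

theorem gradient_globalObjective {p : Fin n → ℝ} {ℓ : Model d → Ξ → ℝ} {D : Fin n → Measure Ξ}
    (hd : ∀ i, Differentiable ℝ (localObjective ℓ D i)) (x : Model d) :
    HasGradientAt (globalObjective p ℓ D) (∑ i, p i • ∇ (localObjective ℓ D i) x) x := by
  rw [hasGradientAt_iff_hasFDerivAt, map_sum]
  simp only [map_smul]
  exact HasFDerivAt.fun_sum fun i _ => ((hd i x).hasGradientAt.hasFDerivAt).const_mul (p i)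

theorem gradient_globalObjective_uniform {p : Fin n → ℝ} (hp : ∀ i, p i = 1 / (n : ℝ))
    {ℓ : Model d → Ξ → ℝ} {D : Fin n → Measure Ξ}
    (hd : ∀ i, Differentiable ℝ (localObjective ℓ D i)) (x : Model d) :
    ∇ (globalObjective p ℓ D) x = (1 / (n : ℝ)) • ∑ i, ∇ (localObjective ℓ D i) x := by
  rw [(gradient_globalObjective hd x).gradient, Finset.smul_sum]
  simp only [hp]

theorem isSmooth_globalObjective (hn : 2 ≤ n) {p : Fin n → ℝ} (hp : ∀ i, p i = 1 / (n : ℝ))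
    {ℓ : Model d → Ξ → ℝ} {D : Fin n → Measure Ξ} {L : ℝ}
    (hs : ∀ i, IsSmooth L (localObjective ℓ D i)) : IsSmooth L (globalObjective p ℓ D) := by
  have hn0 : (0 : ℝ) < n := by positivity
  refine ⟨fun x => (gradient_globalObjective (fun i => (hs i).1) x).hasFDerivAt.differentiableAt,
    fun x y => ?_⟩
  rw [gradient_globalObjective_uniform hp fun i => (hs i).1,
    gradient_globalObjective_uniform hp fun i => (hs i).1, ← smul_sub, ← Finset.sum_sub_distrib,
    norm_smul, Real.norm_of_nonneg (by positivity), one_div, inv_mul_le_iff₀ hn0]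
  refine (norm_sum_le _ _).trans ((Finset.sum_le_sum fun i _ => (hs i).2 x y).trans (le_of_eq ?_))
  simp

theorem gradient_eq_zero_of_forall_le {f : Model d → ℝ} {x : Model d} (h : ∀ y, f x ≤ f y) :
    ∇ f x = 0 := by
  have : IsLocalMin f x := Eventually.of_forall h
  rw [gradient, this.fderiv_eq_zero, map_zero]

/-- Lyapunov function: suboptimality of the average plus a multiple of the dispersion. -/
noncomputable def potential (f : Model d → ℝ) (fmin β : ℝ) (x : Fin n → Model d) : ℝ :=
  f (average x) - fmin + β * dispersion x

theorem dispersion_nonneg (x : Fin n → Model d) : 0 ≤ dispersion x :=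
  Finset.sum_nonneg fun _ _ => sq_nonneg _

/-- Expected decrease of the potential in one iteration of SWIFT. -/
theorem lintegral_potential_averagedStep_le (hn : 2 ≤ n) (hM : 1 ≤ M) {p : Fin n → ℝ}
    (hp : ∀ i, p i = 1 / (n : ℝ)) {ℓ : Model d → Ξ → ℝ} {D : Fin n → Measure Ξ}
    [∀ i, IsProbabilityMeasure (D i)] (hloss : IsLoss ℓ D) {L σ ζ γ κ : ℝ} (hL : 0 ≤ L)
    (hsmooth : ∀ i, IsSmooth L (localObjective ℓ D i)) (hunb : UnbiasedGradient ℓ D)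
    (hvar : BoundedVariance p ℓ D σ ζ) (hγ : 0 ≤ γ) (hκ0 : 0 < κ) (hκ1 : κ ≤ 1)
    (hγκ : γ * L ≤ 2 * κ ^ 2 / 193) (hγn : γ * L * n ≤ 1 / 2)
    {w : Fin n → Fin n → ℝ} (hsum : ∀ i, ∑ j, w j i = 1) (hsum' : ∀ j, ∑ i, w j i = 1)
    (hw : ∀ y : Fin n → Model d, ∑ i, y i = 0 →
      ∑ i, ‖∑ k, w k i • y k‖ ^ 2 ≤ (1 - 2 * κ) * ∑ i, ‖y i‖ ^ 2)
    {fmin : ℝ} (hmin : ∀ x, fmin ≤ globalObjective p ℓ D x) (x : Fin n → Model d) :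
    ∫⁻ z, ENNReal.ofReal (potential (globalObjective p ℓ D) fmin (5 * L / (n ^ 2 * κ))
          (averagedStep ℓ w γ x z)) ∂(stepLaw M p D)
        + ENNReal.ofReal (γ / (2 * n) * ‖∇ (globalObjective p ℓ D) (average x)‖ ^ 2)
      ≤ ENNReal.ofReal (potential (globalObjective p ℓ D) fmin (5 * L / (n ^ 2 * κ)) x)
        + ENNReal.ofReal (11 / 2 * (L * γ ^ 2 / (n ^ 2 * κ ^ 2)) * (6 * ζ ^ 2 + σ ^ 2 / M)) := by
  have hn0 : (0 : ℝ) < n := by positivity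
  have hM0 : (0 : ℝ) < M := by positivity
  set f := globalObjective p ℓ D with hf
  set fi := localObjective ℓ D with hfi
  set β := 5 * L / (n ^ 2 * κ) with hβ
  have hβ0 : 0 ≤ β := by positivity
  have hfs : IsSmooth L f := isSmooth_globalObjective hn hp hsmooth
  have hgrad : ∀ y, ∇ f y = (1 / (n : ℝ)) • ∑ i, ∇ (fi i) y := fun y =>
    gradient_globalObjective_uniform hp (fun i => (hsmooth i).1) y
  set C := γ ^ 2 * (L / (2 * n ^ 2) + β) with hC
  have hC0 : 0 ≤ C := by positivity
  have hpot : ∀ y : Fin n → Model d, 0 ≤ potential f fmin β y := fun y =>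
    add_nonneg (sub_nonneg.2 (hmin _)) (mul_nonneg hβ0 (dispersion_nonneg y))
  set a : Fin n → ℝ := fun i => f (average x)
        + 1 / n * inner ℝ (∇ f (average x)) (∑ k, w k i • x k - x i - γ • ∇ (fi i) (x i))
        + L / (2 * n ^ 2) * ‖∑ k, w k i • x k - x i - γ • ∇ (fi i) (x i)‖ ^ 2
        + β * (dispersion x - ‖x i - average x‖ ^ 2
          + ‖∑ k, w k i • x k - average x - γ • ∇ (fi i) (x i)‖ ^ 2) with ha
  have hζ : 1 / (n : ℝ) * ∑ i, ‖∇ f (average x) - ∇ (fi i) (average x)‖ ^ 2 ≤ ζ ^ 2 := by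
    have := hvar.inter (average x)
    simp only [hp, ← Finset.mul_sum] at this
    exact this
  have hmean : 1 / (n : ℝ) * ∑ i, a i ≤ f (average x) + β * dispersion x
      - γ / (2 * n) * ‖∇ f (average x)‖ ^ 2 + 33 * L * γ ^ 2 / (n ^ 2 * κ ^ 2) * ζ ^ 2 :=
    mean_potential_step_le hn hL hγ hκ0 hκ1 hγκ hγn hsum hsum' hw hsmooth hgrad x hζ
  have hmeas : Measurable (fun z : Fin n × (Fin M → Ξ) =>
      ENNReal.ofReal (potential f fmin β (averagedStep ℓ w γ x z))) := by
    have h1 : Measurable (potential (n := n) f fmin β) :=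
      ((hfs.1.continuous.measurable.comp measurable_average).sub_const _).add
        (measurable_dispersion.const_mul _)
    exact (h1.comp ((measurable_averagedStep hloss.measurable hloss.differentiable w γ).comp
      measurable_prodMk_left)).ennreal_ofReal
  have hstep : ∀ i, 0 ≤ a i - fmin + C * (σ ^ 2 / M) ∧
      ∫⁻ ξ, ENNReal.ofReal (potential f fmin β (averagedStep ℓ w γ x (i, ξ)))
        ∂(Measure.pi fun _ : Fin M => D i) ≤ ENNReal.ofReal (a i - fmin + C * (σ ^ 2 / M)) := by
    intro i
    have hY1 : Integrable (fun ξ => lossGradient ℓ (x i) ξ - ∇ (fi i) (x i)) (D i) :=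
      (hunb i (x i)).1.sub (integrable_const _)
    have hY : MemLp (fun ξ => lossGradient ℓ (x i) ξ - ∇ (fi i) (x i)) 2 (D i) := by
      rw [memLp_two_iff_integrable_sq_norm hY1.1]
      simp only [norm_sub_rev (lossGradient ℓ (x i) _)]
      exact hvar.intra_integrable i (x i)
    have hY0 : ∫ ξ, (lossGradient ℓ (x i) ξ - ∇ (fi i) (x i)) ∂(D i) = 0 := by
      rw [integral_sub (hunb i (x i)).1 (integrable_const _), (hunb i (x i)).2]
      simp [hfi]
    have hYσ : ∫ ξ, ‖lossGradient ℓ (x i) ξ - ∇ (fi i) (x i)‖ ^ 2 ∂(D i) ≤ σ ^ 2 := by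
      simp only [norm_sub_rev (lossGradient ℓ (x i) _)]
      exact hvar.intra i (x i)
    obtain ⟨he, he0, heσ⟩ := batch_noise hM hY hY0 hYσ
    -- The noise is centred, so the coefficient `b` of its linear term never has to be bounded.
    refine lintegral_ofReal_le_of_le_quadratic he he0 heσ (fun ξ => hpot _) hC0
      (b := -(γ / n) • ∇ f (average x)
          - (L * γ / n ^ 2) • (∑ k, w k i • x k - x i - γ • ∇ (fi i) (x i))
          - (2 * β * γ) • (∑ k, w k i • x k - average x - γ • ∇ (fi i) (x i))) fun ξ => ?_
    have hb : batchGradient ℓ (x i) ξ = ∇ (fi i) (x i)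
        + (1 / (M : ℝ)) • ∑ m, (lossGradient ℓ (x i) (ξ m) - ∇ (fi i) (x i)) := by
      rw [batchGradient, Finset.sum_sub_distrib, Finset.sum_const, Finset.card_univ,
        Fintype.card_fin, smul_sub, ← Nat.cast_smul_eq_nsmul ℝ, smul_smul,
        one_div_mul_cancel hM0.ne', one_smul, add_sub_cancel]
    have h := potential_step_le hn (γ := γ) hβ0 hfs x i (∑ k, w k i • x k) (∇ (fi i) (x i))
      ((1 / (M : ℝ)) • ∑ m, (lossGradient ℓ (x i) (ξ m) - ∇ (fi i) (x i)))
    rw [← hb] at h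
    simp only [potential, averagedStep, ha, hC]
    linarith
  have hsum1 : ∑ i, ENNReal.ofReal (p i) * ∫⁻ ξ, ENNReal.ofReal
        (potential f fmin β (averagedStep ℓ w γ x (i, ξ))) ∂(Measure.pi fun _ : Fin M => D i)
      ≤ ENNReal.ofReal (1 / n * ∑ i, (a i - fmin + C * (σ ^ 2 / M))) := by
    rw [Finset.mul_sum, ENNReal.ofReal_sum_of_nonneg
      fun i _ => mul_nonneg (by positivity) (hstep i).1]
    refine Finset.sum_le_sum fun i _ => ?_
    rw [hp, ENNReal.ofReal_mul (by positivity)]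
    exact mul_le_mul_right (hstep i).2 _
  have hnn : 0 ≤ 1 / (n : ℝ) * ∑ i, (a i - fmin + C * (σ ^ 2 / M)) :=
    mul_nonneg (by positivity) (Finset.sum_nonneg fun i _ => (hstep i).1)
  have hsum2 : 1 / (n : ℝ) * ∑ i, (a i - fmin + C * (σ ^ 2 / M))
      = 1 / n * ∑ i, a i - fmin + C * (σ ^ 2 / M) := by
    simp only [Finset.sum_add_distrib, Finset.sum_sub_distrib, Finset.sum_const, Finset.card_univ,
      Fintype.card_fin, nsmul_eq_mul]
    field_simp
  -- κ²/2 + 5κ ≤ 11/2 since κ ≤ 1. With 33 = 6 · 11/2, variance and heterogeneity combine into 6ζ² +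
  -- σ²/M.
  have hCσ : C * (σ ^ 2 / M) ≤ 11 / 2 * (L * γ ^ 2 / (n ^ 2 * κ ^ 2)) * (σ ^ 2 / M) := by
    refine mul_le_mul_of_nonneg_right ?_ (by positivity)
    have h1 : C = L * γ ^ 2 / (n ^ 2 * κ ^ 2) * (κ ^ 2 / 2 + 5 * κ) := by
      simp only [hC, hβ]; field_simp
    rw [h1, mul_comm (11 / 2 : ℝ)]
    refine mul_le_mul_of_nonneg_left ?_ (by positivity)
    nlinarith
  rw [lintegral_stepLaw p D hmeas]
  refine (add_le_add hsum1 le_rfl).trans ?_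
  rw [← ENNReal.ofReal_add hnn (by positivity), ← ENNReal.ofReal_add (hpot x) (by positivity)]
  refine ENNReal.ofReal_le_ofReal ?_
  rw [hsum2]
  have h33 : 33 * L * γ ^ 2 / (n ^ 2 * κ ^ 2) * ζ ^ 2
      = 11 / 2 * (L * γ ^ 2 / (n ^ 2 * κ ^ 2)) * (6 * ζ ^ 2) := by ring
  rw [h33] at hmean
  simp only [potential]
  rw [mul_add]
  linarith

end Reduction

/-! ### Step size, connectivity constant and final rate -/

section Constants

/-- The two lower bounds on the connectivity constant which the analysis uses. -/
theorem rhoNu_bounds {n B : ℕ} (hn : 2 ≤ n) (hB : 0 < B) {ρ : ℝ} (hρ0 : 0 ≤ ρ) (hρ1 : ρ < 1) :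
    1 / (1 - √ρ) ^ 2 ≤ 2 * rhoNu n ρ (nu n B) ∧ 96 * (n : ℝ) ^ 2 ≤ rhoNu n ρ (nu n B) := by
  have hn2 : (2 : ℝ) ≤ n := by exact_mod_cast hn
  have hs0 := Real.sqrt_nonneg ρ
  have hsq := Real.sq_sqrt hρ0
  have hs1 : √ρ < 1 := by nlinarith
  set κ := 1 - √ρ with hκ
  have hκ0 : 0 < κ := by linarith
  -- This half accounts for the 2 in 1/κ² ≤ 2ρ_ν and for 96 = 192/2.
  have hhalf : 1 / 2 ≤ ((n : ℝ) - 1) / n := by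
    rw [div_le_div_iff₀ (by norm_num) (by linarith)]; linarith
  have h1 : 7 / (4 * κ) ≤ 7 / (2 * (1 - ρ)) := by
    refine div_le_div_of_nonneg_left (by norm_num) (by linarith) ?_
    nlinarith
  -- The middle term of ρ_ν falls short of 1/κ² by 1/κ, which the first term, at least 7/(4κ), makes
  -- up for.
  have h2 : √ρ / κ ^ 2 = 1 / κ ^ 2 - 1 / κ := by
    have : √ρ = 1 - κ := by rw [hκ]; ring
    rw [this]; field_simp
  -- A root of order B ≥ 1 does not decrease a number in [0, 1], so ν ≥ 1 - n^(-nB) ≥ 1 - n⁻² and 1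
  -- - ν² ≤ 2/n².
  have h3 : 192 * (n : ℝ) ^ 2 ≤ 384 / (1 - nu n B ^ 2) := by
    set u := 1 / (n : ℝ) ^ (n * B) with hu
    have hpow : (n : ℝ) ^ 2 ≤ (n : ℝ) ^ (n * B) :=
      pow_le_pow_right₀ (by linarith) (by nlinarith)
    have hu0 : 0 < u := by positivity
    have hu1 : u ≤ 1 / (n : ℝ) ^ 2 := one_div_le_one_div_of_le (by positivity) hpow
    have hu2 : u < 1 := lt_of_le_of_lt hu1 (by
      rw [div_lt_one (by positivity)]; nlinarith)
    have hB1 : (1 : ℝ) ≤ B := by exact_mod_cast hB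
    have hν1 : 1 - u ≤ nu n B := by
      rw [nu, ← hu]
      calc 1 - u = (1 - u) ^ (1 : ℝ) := (Real.rpow_one _).symm
        _ ≤ (1 - u) ^ (1 / (B : ℝ)) :=
          Real.rpow_le_rpow_of_exponent_ge (by linarith) (by linarith)
            ((div_le_one (by linarith)).2 hB1)
    have hν2 : nu n B < 1 := by
      rw [nu, ← hu]
      exact Real.rpow_lt_one (by linarith) (by linarith) (by positivity)
    have h4 : 0 < 1 - nu n B ^ 2 := by nlinarith
    rw [le_div_iff₀ h4]
    have h5 : 1 - nu n B ^ 2 ≤ 2 * (1 / (n : ℝ) ^ 2) := by nlinarith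
    calc 192 * (n : ℝ) ^ 2 * (1 - nu n B ^ 2) ≤ 192 * (n : ℝ) ^ 2 * (2 * (1 / (n : ℝ) ^ 2)) := by
          gcongr
      _ = 384 := by field_simp; norm_num
  have h4 : 1 / κ ≤ 7 / (4 * κ) := by
    rw [div_le_div_iff₀ hκ0 (by positivity)]; linarith
  have h5 : 0 ≤ 1 / κ ^ 2 := by positivity
  have h6 : 0 ≤ √ρ / κ ^ 2 := by positivity
  have h7 : 0 ≤ 7 / (4 * κ) := by positivity
  have h8 : (0 : ℝ) ≤ 192 * (n : ℝ) ^ 2 := by positivity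
  have h9 : 1 / 2 * (7 / (2 * (1 - ρ)) + √ρ / κ ^ 2 + 384 / (1 - nu n B ^ 2))
      ≤ rhoNu n ρ (nu n B) := by
    rw [rhoNu]
    exact mul_le_mul_of_nonneg_right hhalf (by linarith)
  constructor <;> linarith

/-- The step size is small under the iteration requirement. -/
theorem stepSize_mul_le {n a b l τ r : ℝ} (ha : 0 < a) (hl : 0 < l)
    (hτ : 0 < τ) (hr : 0 < r) (hreq : 193 * l * a * b * r * n ≤ τ) :
    n * a * b / (τ * l + a) * l ^ 2 ≤ 1 / (193 * r) := by
  rw [div_mul_eq_mul_div, div_le_div_iff₀ (by positivity) (by positivity)]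
  have h1 := mul_le_mul_of_nonneg_right hreq hl.le
  nlinarith

/-- Final bound on the averaged squared gradients, in terms of the square roots `a`, `b`, `l`, `τ`
of the batch size, the initial gap, the smoothness constant and the number of iterations. -/
theorem averaged_bound {n a b l τ r κ σ ζ S γ : ℝ} (hn : 0 < n) (ha : 0 < a) (hb : 0 < b)
    (hl : 0 < l) (hτ : 0 < τ) (hκ0 : 0 < κ) (hr0 : 0 ≤ r) (hr : 1 / κ ^ 2 ≤ 2 * r)
    (hγ : γ = n * a * b / (τ * l + a))
    (hS : γ / (2 * n) * S ≤ b ^ 2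
      + τ ^ 2 * (11 / 2 * (l ^ 2 * γ ^ 2 / (n ^ 2 * κ ^ 2)) * (6 * ζ ^ 2 + σ ^ 2 / a ^ 2))) :
    1 / τ ^ 2 * S ≤ 2 * b / τ ^ 2
      + 2 * (l * b) * (1 + 1921 / 20 * r * (σ ^ 2 + 6 * a ^ 2 * ζ ^ 2)) / (τ * a) := by
  have hden : 0 < τ * l + a := by positivity
  have hγ0 : 0 < γ := by rw [hγ]; positivity
  set N := σ ^ 2 + 6 * a ^ 2 * ζ ^ 2 with hN
  have hN0 : 0 ≤ N := by positivity
  have hN1 : 6 * ζ ^ 2 + σ ^ 2 / a ^ 2 = N / a ^ 2 := by rw [hN]; field_simp; ring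
  rw [hN1] at hS
  have h1 : S ≤ 2 * n / γ * (b ^ 2
      + τ ^ 2 * (11 / 2 * (l ^ 2 * γ ^ 2 / (n ^ 2 * κ ^ 2)) * (N / a ^ 2))) := by
    have := mul_le_mul_of_nonneg_left hS (by positivity : 0 ≤ 2 * n / γ)
    refine le_trans (le_of_eq ?_) this
    field_simp
  have h2 : 1 / τ ^ 2 * (2 * n / γ * (b ^ 2
      + τ ^ 2 * (11 / 2 * (l ^ 2 * γ ^ 2 / (n ^ 2 * κ ^ 2)) * (N / a ^ 2))))
      = 2 * n * b ^ 2 / (γ * τ ^ 2) + 11 * (1 / κ ^ 2) * (l ^ 2 * (γ / n)) * (N / a ^ 2) := by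
    field_simp
  -- The two summands in the denominator of γ produce exactly the two noise-free terms of the bound.
  have h3 : 2 * n * b ^ 2 / (γ * τ ^ 2) = 2 * b / τ ^ 2 + 2 * (l * b) / (τ * a) := by
    rw [hγ]; field_simp; ring
  have h4 : l ^ 2 * (γ / n) ≤ l * (a * b) / τ := by
    have : γ / n = a * b / (τ * l + a) := by rw [hγ]; field_simp
    rw [this]
    calc l ^ 2 * (a * b / (τ * l + a)) ≤ l ^ 2 * (a * b / (τ * l)) := by
          gcongr; linarith
      _ = _ := by field_simp
  have h5 : 11 * (1 / κ ^ 2) * (l ^ 2 * (γ / n)) * (N / a ^ 2)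
      ≤ 11 * (2 * r) * (l * (a * b) / τ) * (N / a ^ 2) := by gcongr
  have h6 : 11 * (2 * r) * (l * (a * b) / τ) * (N / a ^ 2) = 22 * (r * N * (l * b / (τ * a))) := by
    field_simp
    ring
  -- The argument needs the coefficient 22 only, well below 1921/10.
  have h7 : 2 * (l * b) * (1 + 1921 / 20 * r * N) / (τ * a)
      = 2 * (l * b) / (τ * a) + 1921 / 10 * (r * N * (l * b / (τ * a))) := by ring
  have h8 : 0 ≤ r * N * (l * b / (τ * a)) := by positivity
  have h9 := mul_le_mul_of_nonneg_left h1 (by positivity : 0 ≤ 1 / τ ^ 2)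
  rw [h2, h3] at h9
  rw [h7]
  linarith

theorem iterationRequirement_uniform {L M Δ r n : ℝ} :
    iterationRequirement L M Δ r n (1 / n) = 193 ^ 2 * L * M * Δ * r ^ 2 * n ^ 2 := by
  rw [iterationRequirement]
  rcases eq_or_ne n 0 with rfl | h
  · simp
  · field_simp

theorem iterationRequirement_isLittleO (L M Δ r : ℝ) {A : ℕ → ℝ}
    (hA : (fun m : ℕ => (m : ℝ) ^ 4) =O[atTop] A) :
    (fun m : ℕ => iterationRequirement L M Δ r m (1 / (m : ℝ))) =o[atTop] A := by
  simp only [iterationRequirement_uniform]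
  refine Asymptotics.IsLittleO.trans_isBigO ?_ hA
  refine Asymptotics.IsLittleO.const_mul_left ?_ _
  exact (Asymptotics.isLittleO_pow_pow_atTop_of_lt (𝕜 := ℝ) (by norm_num : 2 < 4)).comp_tendsto
    tendsto_natCast_atTop_atTop

/-- √T ≤ T for T ≥ 1; for T = 0 both sides are 0 by the convention on division. -/
theorem rate_le {T : ℕ} {M : ℕ} (b c : ℝ) (hb : 0 ≤ b) :
    2 * b / T + c / √(T * M) ≤ (2 * b + c / √M) / √T := by
  rcases Nat.eq_zero_or_pos T with rfl | hT
  · simp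
  have hT1 : (1 : ℝ) ≤ T := by exact_mod_cast hT
  have hs : 0 < √(T : ℝ) := Real.sqrt_pos.2 (by linarith)
  have h1 : √(T : ℝ) ≤ T := by
    rw [Real.sqrt_le_left (by linarith)]; nlinarith
  rw [add_div, Real.sqrt_mul (by linarith), div_div, mul_comm (√(M : ℝ))]
  gcongr

end Constants

/-! ### Summing the drift over the run -/

section Convergence

variable {n d M T : ℕ} {Ξ Ω : Type*} [MeasurableSpace Ξ] [MeasurableSpace Ω]

/-- Sum of the expected squared gradients along SWIFT with averaging at each iteration. -/
theorem sum_integral_gradient_le {μ : Measure Ω} [IsProbabilityMeasure μ] (hn : 2 ≤ n)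
    (hM : 1 ≤ M) {p : Fin n → ℝ}
    (hp : ∀ i, p i = 1 / (n : ℝ)) {ℓ : Model d → Ξ → ℝ} {D : Fin n → Measure Ξ}
    [∀ i, IsProbabilityMeasure (D i)] (hloss : IsLoss ℓ D) {L σ ζ γ κ : ℝ} (hL : 0 ≤ L)
    (hsmooth : ∀ i, IsSmooth L (localObjective ℓ D i)) (hunb : UnbiasedGradient ℓ D)
    (hvar : BoundedVariance p ℓ D σ ζ) (hγ : 0 < γ) (hκ0 : 0 < κ) (hκ1 : κ ≤ 1)
    (hγκ : γ * L ≤ 2 * κ ^ 2 / 193) (hγn : γ * L * n ≤ 1 / 2)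
    {w : ℕ → Fin n → Fin n → ℝ} (hsum : ∀ t < T, ∀ i, ∑ j, w t j i = 1)
    (hsum' : ∀ t < T, ∀ j, ∑ i, w t j i = 1)
    (hw : ∀ t < T, ∀ y : Fin n → Model d, ∑ i, y i = 0 →
      ∑ i, ‖∑ k, w t k i • y k‖ ^ 2 ≤ (1 - 2 * κ) * ∑ i, ‖y i‖ ^ 2)
    {fmin : ℝ} (hmin : ∀ x, fmin ≤ globalObjective p ℓ D x) (x0 : Model d)
    {act : ℕ → Ω → Fin n} {data : ℕ → Ω → Fin M → Ξ} (hsamp : IsSampling μ p D act data)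
    {xbar : ℕ → Ω → Model d}
    (hxbar : ∀ t < T, ∀ ω, xbar t ω = average (iterates (fun t => averagedStep ℓ (w t) γ)
      (fun _ => x0) (fun k => (act k ω, data k ω)) t)) :
    (∀ t < T, Integrable (fun ω => ‖∇ (globalObjective p ℓ D) (xbar t ω)‖ ^ 2) μ) ∧
    γ / (2 * n) * ∑ t ∈ Finset.range T, ∫ ω, ‖∇ (globalObjective p ℓ D) (xbar t ω)‖ ^ 2 ∂μ
      ≤ globalObjective p ℓ D x0 - fmin
        + T * (11 / 2 * (L * γ ^ 2 / (n ^ 2 * κ ^ 2)) * (6 * ζ ^ 2 + σ ^ 2 / M)) := by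
  have hn0 : (0 : ℝ) < n := by positivity
  set f := globalObjective p ℓ D with hf
  set β := 5 * L / (n ^ 2 * κ) with hβ
  set K := 11 / 2 * (L * γ ^ 2 / (n ^ 2 * κ ^ 2)) * (6 * ζ ^ 2 + σ ^ 2 / M) with hK
  have hK0 : 0 ≤ K := by positivity
  have hfs : IsSmooth L f := isSmooth_globalObjective hn hp hsmooth
  have hc : 0 < γ / (2 * n) := by positivity
  have hgc : Continuous (∇ f) :=
    (LipschitzWith.of_dist_le_mul (K := ⟨L, hL⟩) fun x y => by
      rw [dist_eq_norm, dist_eq_norm]; exact hfs.2 x y).continuous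
  have hstep : ∀ t, Measurable (Function.uncurry (averagedStep (M := M) ℓ (w t) γ)) := fun t =>
    measurable_averagedStep hloss.measurable hloss.differentiable (w t) γ
  have hξ : ∀ t, Measurable (fun ω => (act t ω, data t ω)) := fun t =>
    (hsamp.measurable_act t).prodMk (hsamp.measurable_data t)
  have hψ : Measurable (fun x : Fin n → Model d => ENNReal.ofReal (potential f fmin β x)) :=
    (((hfs.1.continuous.measurable.comp measurable_average).sub_const _).add
      (measurable_dispersion.const_mul _)).ennreal_ofReal
  have hφ' : Measurable (fun x : Fin n → Model d => γ / (2 * n) * ‖∇ f (average x)‖ ^ 2) :=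
    ((hgc.measurable.comp measurable_average).norm.pow_const 2).const_mul _
  have hmain := lintegral_iterates_add_sum_le (s0 := fun _ : Fin n => x0) hstep hξ hsamp.indep
    hsamp.law hψ hφ'.ennreal_ofReal (K := ENNReal.ofReal K) (T := T) (fun t ht x =>
      lintegral_potential_averagedStep_le hn hM hp hloss hL hsmooth hunb hvar hγ.le hκ0 hκ1 hγκ hγn
        (hsum t ht) (hsum' t ht) (hw t ht) hmin x)
  set X : ℕ → Ω → Fin n → Model d := fun t ω => iterates (fun t => averagedStep ℓ (w t) γ)
      (fun _ => x0) (fun k => (act k ω, data k ω)) t with hX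
  have hXm : ∀ t, Measurable (X t) := measurable_iterates hstep hξ
  have hpot0 : potential f fmin β (fun _ : Fin n => x0) = f x0 - fmin := by
    simp [potential, dispersion, average_const hn]
  have hbound : ∑ t ∈ Finset.range T,
      ∫⁻ ω, ENNReal.ofReal (γ / (2 * n) * ‖∇ f (average (X t ω))‖ ^ 2) ∂μ
      ≤ ENNReal.ofReal (f x0 - fmin + T * K) := by
    refine (le_add_self.trans hmain).trans (le_of_eq ?_)
    rw [hpot0, ENNReal.ofReal_add (sub_nonneg.2 (hmin x0)) (by positivity),
      ENNReal.ofReal_mul (Nat.cast_nonneg T), ENNReal.ofReal_natCast]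
  have hnn : ∀ t ω, 0 ≤ γ / (2 * n) * ‖∇ f (average (X t ω))‖ ^ 2 := fun t ω => by positivity
  -- Integrability is a by-product: each term is at most the whole sum, which is finite in [0, ∞].
  have hint : ∀ t < T, Integrable (fun ω => γ / (2 * n) * ‖∇ f (average (X t ω))‖ ^ 2) μ := by
    intro t ht
    refine ⟨(hφ'.comp (hXm t)).aestronglyMeasurable, ?_⟩
    rw [hasFiniteIntegral_iff_ofReal (Eventually.of_forall (hnn t))]
    refine lt_of_le_of_lt ?_ (lt_of_le_of_lt hbound ENNReal.ofReal_lt_top)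
    exact Finset.single_le_sum
      (f := fun t => ∫⁻ ω, ENNReal.ofReal (γ / (2 * n) * ‖∇ f (average (X t ω))‖ ^ 2) ∂μ)
      (fun _ _ => zero_le) (Finset.mem_range.2 ht)
  have hxX : ∀ t < T, (fun ω => ‖∇ f (xbar t ω)‖ ^ 2) = fun ω => ‖∇ f (average (X t ω))‖ ^ 2 :=
    fun t ht => funext fun ω => by rw [hxbar t ht ω]
  refine ⟨fun t ht => ?_, ?_⟩
  · rw [hxX t ht]
    have := (hint t ht).const_mul (γ / (2 * n))⁻¹
    simpa only [inv_mul_cancel_left₀ hc.ne'] using this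
  · have hΔ0 : 0 ≤ f x0 - fmin + T * K :=
      add_nonneg (sub_nonneg.2 (hmin x0)) (by positivity)
    rw [← ENNReal.ofReal_le_ofReal_iff hΔ0]
    refine le_trans (le_of_eq ?_) hbound
    rw [Finset.mul_sum, ENNReal.ofReal_sum_of_nonneg fun t _ =>
      mul_nonneg hc.le (integral_nonneg fun ω => sq_nonneg _)]
    refine Finset.sum_congr rfl fun t ht => ?_
    have ht' := Finset.mem_range.1 ht
    rw [hxX t ht', ← integral_const_mul, ofReal_integral_eq_lintegral_ofReal (hint t ht')
      (Eventually.of_forall (hnn t))]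

end Convergence

end Swift

/-! ### The corollary -/

theorem mainTheorem3
    {n d M s T B : ℕ} (hn : 2 ≤ n) (hM : 1 ≤ M)
    {Ξ : Type*} [MeasurableSpace Ξ]
    {Ω : Type*} [MeasurableSpace Ω] (μ : Measure Ω) [IsProbabilityMeasure μ]
    -- uniform client influence scores
    (p : Fin n → ℝ) (hp : ∀ i, p i = 1 / (n : ℝ))
    -- loss and data distributions
    (ℓ : Swift.Model d → Ξ → ℝ) (D : Fin n → Measure Ξ) [∀ i, IsProbabilityMeasure (D i)]
    (hloss : Swift.IsLoss ℓ D)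
    (L σ ζ : ℝ) (hL : 0 ≤ L) (hσ : 0 ≤ σ) (hζ : 0 ≤ ζ)
    (hsmooth : ∀ i, Swift.IsSmooth L (Swift.localObjective ℓ D i))
    (hunbiased : Swift.UnbiasedGradient ℓ D)
    (hvar : Swift.BoundedVariance p ℓ D σ ζ)
    -- communication graphs and client communication coefficients
    (G : ℕ → SimpleGraph (Fin n)) (hG : Swift.UniformlyConnected G B)
    (w : ℕ → Fin n → Fin n → ℝ) (hw : ∀ t, Swift.IsCommWeights (G t) (w t))
    (hsymm : ∀ t < T, ∀ (a : ℕ → Fin n) (i j : Fin n),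
      p j * Swift.activeCoeff w s T a t i j = p i * Swift.activeCoeff w s T a t j i)
    (ρ : ℝ) (hρ0 : 0 ≤ ρ) (hρ1 : ρ < 1)
    (hρ : ∀ t < T, ∀ a : ℕ → Fin n,
      max |Swift.gramEigenvalue
            (Swift.expectedCommMatrix p (Swift.activeCoeff w s T a t)) ⟨1, by omega⟩|
          |Swift.gramEigenvalue
            (Swift.expectedCommMatrix p (Swift.activeCoeff w s T a t)) ⟨n - 1, by omega⟩| ≤ ρ)
    -- common initial model, and a minimizer of the global objective
    (x0 xstar : Swift.Model d)
    (hxstar : ∀ x, Swift.globalObjective p ℓ D xstar ≤ Swift.globalObjective p ℓ D x)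
    (Δ : ℝ) (hΔ : Δ = Swift.globalObjective p ℓ D x0 - Swift.globalObjective p ℓ D xstar)
    (r : ℝ) (hr : r = Swift.rhoNu n ρ (Swift.nu n B))
    -- random active clients and mini-batches, and the average models of SWIFT
    (act : ℕ → Ω → Fin n) (data : ℕ → Ω → Fin M → Ξ)
    (hsamp : Swift.IsSampling μ p D act data)
    (xbar : ℕ → Ω → Swift.Model d)
    (hxbar : ∀ t ω, xbar t ω = Swift.average
      (Swift.models ℓ w s T (Swift.stepSize n M T L Δ) x0
        (fun k => act k ω) (fun k => data k ω) t)) :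
    -- the iteration requirement is of order `n ^ 2`
    (⨆ i, p i) = 1 / (n : ℝ) ∧
    Swift.iterationRequirement L M Δ r n (⨆ i, p i) = 193 ^ 2 * L * M * Δ * r ^ 2 * (n : ℝ) ^ 2 ∧
    -- and thus of smaller order than any requirement of order at least `n ^ 4`
    (∀ A : ℕ → ℝ, (fun m : ℕ => (m : ℝ) ^ 4) =O[atTop] A →
      (fun m : ℕ => Swift.iterationRequirement L M Δ r m (1 / (m : ℝ))) =o[atTop] A) ∧
    -- convergence under this requirement
    (193 ^ 2 * L * M * Δ * r ^ 2 * (n : ℝ) ^ 2 ≤ (T : ℝ) →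
      (∀ t < T, Integrable
        (fun ω => ‖gradient (Swift.globalObjective p ℓ D) (xbar t ω)‖ ^ 2) μ) ∧
      (1 / (T : ℝ)) * ∑ t ∈ Finset.range T,
          ∫ ω, ‖gradient (Swift.globalObjective p ℓ D) (xbar t ω)‖ ^ 2 ∂μ
        ≤ 2 * √Δ / T
          + 2 * √(L * Δ) * (1 + 1921 / 20 * r * (σ ^ 2 + 6 * M * ζ ^ 2)) / √(T * M) ∧
      2 * √Δ / T
          + 2 * √(L * Δ) * (1 + 1921 / 20 * r * (σ ^ 2 + 6 * M * ζ ^ 2)) / √(T * M)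
        ≤ (2 * √Δ + 2 * √(L * Δ) * (1 + 1921 / 20 * r * (σ ^ 2 + 6 * M * ζ ^ 2)) / √M) / √T) := by

  have hn0 : (0 : ℝ) < n := by positivity
  have hM0 : (0 : ℝ) < M := by exact_mod_cast hM
  have : Nonempty (Fin n) := ⟨⟨0, by omega⟩⟩
  have hpmax : (⨆ i, p i) = 1 / (n : ℝ) := by simp only [hp, ciSup_const]
  obtain ⟨hr1, hr2⟩ := Swift.rhoNu_bounds hn hG.1 hρ0 hρ1
  rw [← hr] at hr1 hr2
  have hr0 : 0 < r := lt_of_lt_of_le (by positivity) hr2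
  have hΔ0 : 0 ≤ Δ := by rw [hΔ]; linarith [hxstar x0]
  refine ⟨hpmax, by rw [hpmax, Swift.iterationRequirement_uniform],
    fun A hA => Swift.iterationRequirement_isLittleO L M Δ r hA, fun hT => ?_⟩
  suffices hmain : (∀ t < T, Integrable
        (fun ω => ‖gradient (Swift.globalObjective p ℓ D) (xbar t ω)‖ ^ 2) μ) ∧
      (1 / (T : ℝ)) * ∑ t ∈ Finset.range T,
          ∫ ω, ‖gradient (Swift.globalObjective p ℓ D) (xbar t ω)‖ ^ 2 ∂μ
        ≤ 2 * √Δ / T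
          + 2 * √(L * Δ) * (1 + 1921 / 20 * r * (σ ^ 2 + 6 * M * ζ ^ 2)) / √(T * M) from
    ⟨hmain.1, hmain.2, Swift.rate_le _ _ (Real.sqrt_nonneg _)⟩
  have hfs := Swift.isSmooth_globalObjective hn hp hsmooth
  have hgstar := Swift.gradient_eq_zero_of_forall_le hxstar
  -- Covers the degenerate cases T = 0, L = 0 and Δ = 0; afterwards every square root to be divided
  -- by is positive.
  have hzero : (∀ t < T, ∀ ω, gradient (Swift.globalObjective p ℓ D) (xbar t ω) = 0) →
      (∀ t < T, Integrable
        (fun ω => ‖gradient (Swift.globalObjective p ℓ D) (xbar t ω)‖ ^ 2) μ) ∧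
      (1 / (T : ℝ)) * ∑ t ∈ Finset.range T,
          ∫ ω, ‖gradient (Swift.globalObjective p ℓ D) (xbar t ω)‖ ^ 2 ∂μ
        ≤ 2 * √Δ / T
          + 2 * √(L * Δ) * (1 + 1921 / 20 * r * (σ ^ 2 + 6 * M * ζ ^ 2)) / √(T * M) := by
    intro h
    refine ⟨fun t ht => by simp [h t ht], ?_⟩
    rw [Finset.sum_eq_zero fun t ht => by simp [h t (Finset.mem_range.1 ht)], mul_zero]
    positivity
  rcases Nat.eq_zero_or_pos T with rfl | hTpos
  · exact hzero fun t ht => absurd ht (Nat.not_lt_zero t)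
  -- If L = 0 the gradient of f is constant, hence equal to its value 0 at the minimizer.
  rcases hL.eq_or_lt with hL0 | hLpos
  · refine hzero fun t _ ω => ?_
    have := hfs.2 (xbar t ω) xstar
    rw [hgstar, ← hL0, zero_mul, sub_zero] at this
    exact norm_le_zero_iff.1 this
  rcases hΔ0.eq_or_lt with hΔz | hΔpos
  · have hx0 : gradient (Swift.globalObjective p ℓ D) x0 = 0 :=
      Swift.gradient_eq_zero_of_forall_le fun y => by linarith [hxstar y]
    have hγ : Swift.stepSize n M T L Δ = 0 := by simp [Swift.stepSize, ← hΔz]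
    refine hzero fun t _ ω => ?_
    rw [hxbar, hγ, Swift.models_of_stepSize_zero ℓ (fun t i => (hw t).sum_eq_one i),
      Swift.average_const hn, hx0]
  -- averaging takes place at each iteration, with symmetric coefficients
  have a0 : ℕ → Fin n := fun _ => ⟨0, by omega⟩
  have hs : s = 0 := Swift.eq_zero_of_gramEigenvalue_lt_one hn hp
    (((le_abs_self _).trans ((le_max_left _ _).trans (hρ 0 hTpos a0))).trans_lt hρ1)
  subst hs
  have hws : ∀ t < T, ∀ i j, w t i j = w t j i := fun t ht i j => by
    have h := hsymm t ht a0 i j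
    rw [Swift.activeCoeff_zero w ht, hp, hp] at h
    exact mul_left_cancel₀ (by positivity) h
  set κ := 1 - √ρ with hκ
  have hs1 : √ρ < 1 := by
    rw [← Real.sqrt_one]; exact Real.sqrt_lt_sqrt hρ0 hρ1
  have hκ0 : 0 < κ := by linarith
  have hκ1 : κ ≤ 1 := by linarith [Real.sqrt_nonneg ρ]
  have hcontr : ∀ t < T, ∀ y : Fin n → Swift.Model d, ∑ i, y i = 0 →
      ∑ i, ‖∑ k, w t k i • y k‖ ^ 2 ≤ (1 - 2 * κ) * ∑ i, ‖y i‖ ^ 2 := fun t ht => by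
    refine Swift.sum_norm_sq_average_le fun z hz => ?_
    refine Swift.sum_sq_average_le hn hp (hws t ht) (hw t).sum_eq_one
      (hw t).nonneg (hw t).diag hρ0 hρ1 ?_ z hz
    have h := (le_abs_self _).trans ((le_max_left _ _).trans (hρ t ht a0))
    rwa [Swift.activeCoeff_zero w ht] at h
  -- the step size
  set γ := Swift.stepSize n M T L Δ with hγdef
  have hT0 : (0 : ℝ) < T := by exact_mod_cast hTpos
  have ha := Real.sqrt_pos.2 hM0
  have hb := Real.sqrt_pos.2 hΔpos
  have hl := Real.sqrt_pos.2 hLpos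
  have hτ := Real.sqrt_pos.2 hT0
  have ha2 := Real.sq_sqrt hM0.le
  have hb2 := Real.sq_sqrt hΔ0
  have hl2 := Real.sq_sqrt hL
  have hτ2 := Real.sq_sqrt hT0.le
  have hγ : γ = n * √(M : ℝ) * √Δ / (√(T : ℝ) * √L + √(M : ℝ)) := by
    rw [hγdef, Swift.stepSize, Real.sqrt_mul (by positivity), Real.sqrt_mul hM0.le,
      Real.sqrt_sq hn0.le, Real.sqrt_mul hT0.le, mul_comm (√(M : ℝ)) (n : ℝ)]
  have hγ0 : 0 < γ := by rw [hγ]; positivity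
  -- The square root of the iteration requirement.
  have hreq : 193 * √L * √(M : ℝ) * √Δ * r * n ≤ √(T : ℝ) := by
    refine Real.le_sqrt_of_sq_le (le_trans (le_of_eq ?_) hT)
    simp only [mul_pow, ha2, hb2, hl2]
  have hγL : γ * L ≤ 1 / (193 * r) := by
    have h := Swift.stepSize_mul_le ha hl hτ hr0 hreq
    rwa [← hγ, hl2] at h
  -- Equivalent, given γL ≤ 1/(193r), to using 1/κ² ≤ 2r; the next bound uses 96n² ≤ r.
  have hγκ : γ * L ≤ 2 * κ ^ 2 / 193 := by
    refine hγL.trans ?_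
    rw [div_le_div_iff₀ (by positivity) (by norm_num)]
    rw [div_le_iff₀ (by positivity)] at hr1
    linarith
  have hγn : γ * L * n ≤ 1 / 2 := by
    refine (mul_le_mul_of_nonneg_right hγL hn0.le).trans ?_
    rw [div_mul_eq_mul_div, div_le_div_iff₀ (by positivity) (by norm_num)]
    have hn2 : (2 : ℝ) ≤ n := by exact_mod_cast hn
    nlinarith
  obtain ⟨hint, hbound⟩ := Swift.sum_integral_gradient_le hn hM hp hloss hL hsmooth hunbiased hvar
    hγ0 hκ0 hκ1 hγκ hγn (w := w) (T := T) (fun t _ => (hw t).sum_eq_one)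
    (fun t ht j => by
      rw [← (hw t).sum_eq_one j]; exact Finset.sum_congr rfl fun i _ => hws t ht j i)
    hcontr hxstar x0 hsamp (xbar := xbar)
    (fun t ht ω => by rw [hxbar, Swift.models_eq_iterates _ _ _ _ _ _ ht.le])
  refine ⟨hint, ?_⟩
  rw [← hΔ] at hbound
  have h := Swift.averaged_bound (τ := √(T : ℝ)) (b := √Δ) (l := √L) (a := √(M : ℝ))
    (σ := σ) (ζ := ζ) hn0 ha hb hl hτ hκ0 hr0.le hr1 hγ (by rw [ha2, hb2, hl2, hτ2]; exact hbound)
  rw [ha2, hτ2, ← Real.sqrt_mul hL, ← Real.sqrt_mul hT0.le] at h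
  exact h
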